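/- For a permutation $w$ (of the positive integers, moving only finitely many of them), let $\ell(w)$ be its number of inversions and let $\mathfrak{S}_w=\sum_{\rho}\sum_{\alpha}x_{\alpha_1}\cdots x_{\alpha_{\ell(w)}}$ be its Schubert polynomial. Here $\rho=(\rho_1,\dots,\rho_{\ell(w)})$ runs over the reduced expressions of $w=s_{\rho_1}\cdots s_{\rho_{\ell(w)}}$, and $\alpha$ runs over the $\rho$-compatible sequences: weakly increasing sequences of positive integers with $\alpha_j\le\rho_j$ for all $j$, and with $\alpha_j<\alpha_{j+1}$ whenever $\rho_j<\rho_{j+1}$. Right multiplication by a transposition $(a,b)$ exchanges the entries in positions $a$ and $b$. **Theorem.** Let $w$ be a permutation whose final descent is at position $k$, that is, $w_k>w_{k+1}$ and $w_i<w_{i+1}$ for all $i>k$. Define $m$ by $k+m=\max\{i\mid w_k>w_i\}$, and let $\hat w=w_1\cdots w_{k-1}\,w_{k+1}\cdots w_{k+m}\,w_k\,w_{k+m+1}\cdots$. Then $\mathfrak{S}_w$ involves only the variables $x_1,\dots,x_k$, and $$\mathfrak{S}_w(x_1,\ldots,x_{k-1},0)=\sum_{u}\mathfrak{S}_u ,$$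 where the sum is over all permutations $u$ of the form $u=\hat w\,(a_1,k)(a_2,k+1)\cdots(a_m,k+m-1)$ with $a_i<k$ for all $i$ and $\ell(u)=\ell(w)$, such that each successive transposition increases the length: $$\ell(\hat w)<\ell(\hat w(a_1,k))<\ell(\hat w(a_1,k)(a_2,k+1))<\cdots<\ell(u).$$ In particular, truncated Schubert polynomials are Schubert-positive: for every permutation $w$ and every $n\ge 0$, the polynomial $\mathfrak{S}_w(x_1,\ldots,x_n,0,0,\ldots)$ is a linear combination of Schubert polynomials with nonnegative integer coefficients. -/

import Mathlib

/-! Permutations, Schubert polynomials and truncation. Positions and values are indexed from `0`: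
the positive integer `i` of one-line notation is `i - 1` here, and `x_i` is `X (i - 1)`.
The product in `Equiv.Perm ℕ` is composition, so `w * Equiv.swap a b` exchanges the entries of `w`
in positions `a` and `b`. -/

namespace SchubertTruncation

/-- `w` moves only finitely many integers, that is, `w` lies in some finite symmetric group. -/
def IsFinitary (w : Equiv.Perm ℕ) : Prop := {i | w i ≠ i}.Finite

/-- The length (number of inversions) of a permutation. -/
noncomputable def len (w : Equiv.Perm ℕ) : ℕ :=
  {p : ℕ × ℕ | p.1 < p.2 ∧ w p.2 < w p.1}.ncard

/-- The word `ρ` is a reduced expression of `w`: the product of the simple transpositions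
`s_i = (i, i+1)`, read from left to right, is `w`, and the word has `ℓ(w)` letters. -/
def IsReducedWord (w : Equiv.Perm ℕ) (ρ : List ℕ) : Prop :=
  (ρ.map fun i => Equiv.swap i (i + 1)).prod = w ∧ ρ.length = len w

/-- The sequence `α` is `ρ`-compatible: it is weakly increasing, strictly where `ρ` increases,
and bounded by `ρ` letter by letter. -/
structure IsCompatible (ρ α : List ℕ) : Prop where
  length_eq : α.length = ρ.length
  weak : ∀ (j : ℕ) (h : j + 1 < ρ.length), α[j] ≤ α[j + 1]
  strict : ∀ (j : ℕ) (h : j + 1 < ρ.length), ρ[j] < ρ[j + 1] → α[j] < α[j + 1]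
  bound : ∀ (j : ℕ) (h : j < ρ.length), α[j] ≤ ρ[j]

/-- The Schubert polynomial of a finitary permutation `w`, as the sum of `x_{α_1} ⋯ x_{α_ℓ}` over
the (finitely many) reduced expressions `ρ` of `w` and `ρ`-compatible sequences `α`. -/
noncomputable def schubert (w : Equiv.Perm ℕ) : MvPolynomial ℕ ℤ :=
  ∑ᶠ p ∈ {p : List ℕ × List ℕ | IsReducedWord w p.1 ∧ IsCompatible p.1 p.2},
    (p.2.map MvPolynomial.X).prod

/-- The truncation `f(x_1, …, x_n, 0, 0, …)` of a polynomial `f` to its first `n` variables. -/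
noncomputable def truncate (n : ℕ) (f : MvPolynomial ℕ ℤ) : MvPolynomial ℕ ℤ :=
  MvPolynomial.aeval (fun i => if i < n then MvPolynomial.X i else 0) f

/-- `f` is a linear combination of Schubert polynomials with coefficients in `ℕ`. -/
def IsSchubertPositive (f : MvPolynomial ℕ ℤ) : Prop :=
  ∃ c : Equiv.Perm ℕ →₀ ℕ, (∀ u ∈ c.support, IsFinitary u) ∧ f = c.sum fun u n => n • schubert u

/-- The final descent of `w` is at position `k`. -/
def IsFinalDescent (w : Equiv.Perm ℕ) (k : ℕ) : Prop :=
  w (k + 1) < w k ∧ ∀ i, k < i → w i < w (i + 1)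

/-- The permutation obtained from `w` by moving the entry in position `k` to position `k + m`:
its one-line notation is that of `w` with the block `w_k w_{k+1} ⋯ w_{k+m}` replaced by
`w_{k+1} ⋯ w_{k+m} w_k`. -/
def hat (w : Equiv.Perm ℕ) (k m : ℕ) : Equiv.Perm ℕ := w * (List.range' k (m + 1)).formPerm

/-- The permutation `v (a_1, k) (a_2, k+1) ⋯ (a_j, k+j-1)`, for `j ≤ m`. -/
def step (v : Equiv.Perm ℕ) (k : ℕ) {m : ℕ} (a : Fin m → Fin k) (j : ℕ) : Equiv.Perm ℕ :=
  v * ((List.ofFn fun i : Fin m => Equiv.swap (a i : ℕ) (k + i)).take j).prod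

open Classical in
/-- The permutations `u = ŵ (a_1, k) (a_2, k+1) ⋯ (a_m, k+m-1)` with all `a_i < k`, such that
every successive transposition increases the length and `ℓ(u) = ℓ(w)`. -/
noncomputable def terms (w : Equiv.Perm ℕ) (k m : ℕ) : Finset (Equiv.Perm ℕ) :=
  (Finset.univ.filter fun a : Fin m → Fin k =>
    (∀ j < m, len (step (hat w k m) k a j) < len (step (hat w k m) k a (j + 1))) ∧
      len (step (hat w k m) k a m) = len w).image fun a => step (hat w k m) k a m

end SchubertTruncation

namespace SchubertTruncation

open Equiv

/-! Write S_w for the Schubert polynomial, t_{ab} for a transposition, positions counted from 0.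
Truncation to `n` variables keeps exactly the biwords (reduced word, compatible sequence) whose
compatible letters are all below `n`. Reading off the last letters gives a recursion for adding the
variable x_n one factor at a time: the factor at `j` either does nothing or removes a descent at `j`
with weight x_n (`partialSchubert_eq_add`). The signed Monk operator, which sums over the covers v
t_{pb}, commutes with this removal up to two correction terms (`monk_descent`). Hence Monk's rule
x_p S_v = ∑_{b>p} S_{v t_{pb}} - ∑_{b<p} S_{v t_{pb}} holds after truncation to any `n`, with x_p
read as 0 for p ≥ n (`monk_truncSchubert`).

Taking n = p = k and v = w t_{k,k+m} makes the left side vanish. Among the covers with b > k only w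
itself occurs, so the truncation of S_w is the sum of the truncations of S_u over the covers u = v
t_{ik} with i < k (`IsDrop.transition`). Each such u has a smaller `m`, and the recursion is
iterated.

The formula results from matching this recursion with chains of covers starting at `hat w k m`.
Whether a step is a cover can be read from the initial permutation alone (`len_chain_succ_iff`). If
the last position used is `i`, then `i` is used in one final run of steps; moving that run to the
front turns the starting point into the `hat` of u and leaves a shorter chain
(`chain_eq_chain_of_const`, `admissible_last`, `IsDrop.truncSchubert_eq_sum`). The endpoints
increase from position `k` on, so truncation does not change their Schubert polynomials. Positivity
follows by repeating this for smaller and smaller final descents. -/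

/-- `w` fixes every integer `i ≥ N`. -/
def FixesFrom (w : Perm ℕ) (N : ℕ) : Prop := ∀ i, N ≤ i → w i = i

theorem FixesFrom.mono {w : Perm ℕ} {M N : ℕ} (h : FixesFrom w M) (hMN : M ≤ N) :
    FixesFrom w N := fun i hi => h i (hMN.trans hi)

theorem FixesFrom.apply_lt {w : Perm ℕ} {N i : ℕ} (h : FixesFrom w N) (hi : i < N) : w i < N := by
  by_contra hc
  have := w.injective (h _ (not_lt.mp hc))
  omega

theorem FixesFrom.mul {v w : Perm ℕ} {N : ℕ} (hv : FixesFrom v N) (hw : FixesFrom w N) :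
    FixesFrom (v * w) N := fun i hi => by
  rw [Perm.mul_apply, hw i hi, hv i hi]

theorem fixesFrom_swap {a b N : ℕ} (ha : a < N) (hb : b < N) : FixesFrom (swap a b) N :=
  fun _ hi => swap_apply_of_ne_of_ne (by omega) (by omega)

theorem FixesFrom.mul_swap {w : Perm ℕ} {a b N : ℕ} (h : FixesFrom w N) (ha : a < N) (hb : b < N) :
    FixesFrom (w * swap a b) N := h.mul (fixesFrom_swap ha hb)

theorem isFinitary_iff (w : Perm ℕ) : IsFinitary w ↔ ∃ N, FixesFrom w N := by
  constructor
  · intro h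
    obtain ⟨N, hN⟩ := h.bddAbove
    refine ⟨N + 1, fun i hi => ?_⟩
    by_contra hc
    have : i ≤ N := hN hc
    omega
  · rintro ⟨N, hN⟩
    refine (Set.finite_lt_nat N).subset fun i hi => ?_
    by_contra hc
    exact hi (hN i (not_lt.mp hc))

theorem IsFinitary.mul {v w : Perm ℕ} (hv : IsFinitary v) (hw : IsFinitary w) :
    IsFinitary (v * w) := by
  obtain ⟨M, hM⟩ := (isFinitary_iff v).1 hv
  obtain ⟨N, hN⟩ := (isFinitary_iff w).1 hw
  exact (isFinitary_iff _).2
    ⟨max M N, (hM.mono (le_max_left _ _)).mul (hN.mono (le_max_right _ _))⟩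

theorem isFinitary_swap (a b : ℕ) : IsFinitary (swap a b) :=
  (isFinitary_iff _).2 ⟨a + b + 1, fixesFrom_swap (by omega) (by omega)⟩

theorem isFinitary_one : IsFinitary 1 := (isFinitary_iff _).2 ⟨0, fun _ _ => rfl⟩

/-! ### Inversions, length and covers -/

/-- The set of inversions of `w`. -/
def inversions (w : Perm ℕ) : Set (ℕ × ℕ) := {p | p.1 < p.2 ∧ w p.2 < w p.1}

theorem finite_inversions {w : Perm ℕ} (h : IsFinitary w) : (inversions w).Finite := by
  obtain ⟨N, hN⟩ := (isFinitary_iff w).1 h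
  refine ((Set.finite_lt_nat N).prod (Set.finite_lt_nat N)).subset ?_
  rintro ⟨i, j⟩ ⟨hij, hw⟩
  simp only at hij hw
  have hj : j < N := by
    by_contra hc
    rw [hN j (not_lt.mp hc)] at hw
    by_cases hi : i < N
    · have := hN.apply_lt hi
      omega
    · rw [hN i (not_lt.mp hi)] at hw
      omega
  exact ⟨hij.trans hj, hj⟩

@[simp] theorem len_one : len 1 = 0 := by
  have : {p : ℕ × ℕ | p.1 < p.2 ∧ (1 : Perm ℕ) p.2 < (1 : Perm ℕ) p.1} = ∅ :=
    Set.eq_empty_of_forall_notMem fun p hp => absurd hp.1 (not_lt.2 hp.2.le)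
  rw [len, this, Set.ncard_empty]

theorem swap_succ_lt_swap_succ {i a b : ℕ} (hab : a < b) (h : ¬(a = i ∧ b = i + 1)) :
    swap i (i + 1) a < swap i (i + 1) b := by
  simp only [swap_apply_def]
  split_ifs <;> omega

theorem len_mul_swap_succ {w : Perm ℕ} (hw : IsFinitary w) {i : ℕ} (h : w i < w (i + 1)) :
    len (w * swap i (i + 1)) = len w + 1 := by
  let e : Perm (ℕ × ℕ) := Equiv.prodCongr (swap i (i + 1)) (swap i (i + 1))
  -- Applying s_i to both positions preserves the order of every pair of positions except (i, i+1),
  -- which becomes the one new inversion.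
  have key : inversions (w * swap i (i + 1)) = insert (i, i + 1) (e '' inversions w) := by
    ext ⟨a, b⟩
    rw [Equiv.image_eq_preimage_symm]
    simp only [inversions, Set.mem_ofPred_eq, Perm.mul_apply, Set.mem_insert_iff, Prod.mk.injEq,
      Set.mem_preimage, e, Equiv.prodCongr_symm, symm_swap, Equiv.prodCongr_apply, Prod.map]
    constructor
    · rintro ⟨hab, hlt⟩
      by_cases hc : a = i ∧ b = i + 1
      · exact Or.inl hc
      · exact Or.inr ⟨swap_succ_lt_swap_succ hab hc, hlt⟩
    · rintro (⟨rfl, rfl⟩ | ⟨hab, hlt⟩)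
      · simpa using h
      · refine ⟨?_, hlt⟩
        have hc : ¬(swap i (i + 1) a = i ∧ swap i (i + 1) b = i + 1) := by
          rintro ⟨h1, h2⟩
          rw [h1, h2] at hlt
          omega
        simpa using swap_succ_lt_swap_succ hab hc
  have hmem : (i, i + 1) ∉ e '' inversions w := by
    rw [Equiv.image_eq_preimage_symm]
    simp [inversions, e]
  change (inversions _).ncard = (inversions _).ncard + 1
  rw [key, Set.ncard_insert_of_notMem hmem ((finite_inversions hw).image _),
    Set.ncard_image_of_injective _ e.injective]

theorem len_mul_swap_succ_of_gt {w : Perm ℕ} (hw : IsFinitary w) {i : ℕ} (h : w (i + 1) < w i) :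
    len w = len (w * swap i (i + 1)) + 1 := by
  have := len_mul_swap_succ (hw.mul (isFinitary_swap i (i + 1))) (i := i) (by simpa using h)
  rwa [mul_assoc, swap_mul_self, mul_one] at this

/-- Induction on the distance, through t_{a,b+1} = s_b t_{ab} s_b. The two factors s_b change the
length in opposite directions unless the value in position b lies strictly between the two exchanged
values, in which case both raise it. -/
theorem len_mul_swap_aux (d : ℕ) : ∀ {w : Perm ℕ}, IsFinitary w → ∀ {a : ℕ},
    w a < w (a + d + 1) → len (w * swap a (a + d + 1)) =
      len w + 1 + 2 * ((Finset.Ioo a (a + d + 1)).filter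
        fun q => w a < w q ∧ w q < w (a + d + 1)).card := by
  induction d with
  | zero =>
    intro w hw a h
    have : Finset.Ioo a (a + 0 + 1) = ∅ := by
      ext x
      simp only [Finset.mem_Ioo, Finset.notMem_empty, iff_false]
      omega
    rw [this]
    simpa using len_mul_swap_succ hw h
  | succ d ih =>
    intro w hw a h
    set b := a + d + 1 with hb
    have hb' : a + (d + 1) + 1 = b + 1 := by omega
    rw [hb'] at h ⊢
    set v := w * swap b (b + 1) with hv
    have hab : a < b := by omega
    have hva : v a = w a := by
      rw [hv, Perm.mul_apply, swap_apply_of_ne_of_ne (by omega) (by omega)]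
    have hvb : v b = w (b + 1) := by simp [hv]
    have hvb' : v (b + 1) = w b := by simp [hv]
    have hvq : ∀ q < b, v q = w q := fun q hq => by
      rw [hv, Perm.mul_apply, swap_apply_of_ne_of_ne (by omega) (by omega)]
    have hvf : IsFinitary v := hw.mul (isFinitary_swap _ _)
    have h1 := ih hvf (a := a) (by rw [hva, ← hb, hvb]; exact h)
    rw [← hb] at h1
    have hconj : w * swap a (b + 1) = v * swap a b * swap b (b + 1) := by
      have : swap b (b + 1) * swap a b * swap b (b + 1) = swap a (b + 1) := by
        rw [Equiv.swap_mul_swap_mul_swap (by omega) (by omega), swap_comm]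
      rw [hv, mul_assoc, mul_assoc, ← mul_assoc (swap b (b + 1)), this]
    set y := v * swap a b with hy
    have hyf : IsFinitary y := hvf.mul (isFinitary_swap _ _)
    have hyb : y b = w a := by simp [hy, hva]
    have hyb' : y (b + 1) = w b := by
      rw [hy, Perm.mul_apply, swap_apply_of_ne_of_ne (by omega) (by omega), hvb']
    have hset : Finset.Ioo a (b + 1) = insert b (Finset.Ioo a b) := by
      ext x
      simp only [Finset.mem_Ioo, Finset.mem_insert]
      omega
    have hfil : ((Finset.Ioo a b).filter fun q => v a < v q ∧ v q < v b) =
        (Finset.Ioo a b).filter fun q => w a < w q ∧ w q < w (b + 1) := by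
      refine Finset.filter_congr fun q hq => ?_
      rw [hva, hvb, hvq q (Finset.mem_Ioo.1 hq).2]
    rw [hfil] at h1
    rw [hconj, hset, Finset.filter_insert]
    have hne : w a ≠ w b := fun hc => by have := w.injective hc; omega
    have hne' : w b ≠ w (b + 1) := fun hc => by have := w.injective hc; omega
    by_cases h2 : w a < w b
    · rw [len_mul_swap_succ hyf (by rw [hyb, hyb']; exact h2), h1]
      by_cases h3 : w b < w (b + 1)
      · rw [if_pos ⟨h2, h3⟩, Finset.card_insert_of_notMem (by simp), len_mul_swap_succ hw h3]
        ring
      · rw [if_neg (fun hc => h3 hc.2)]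
        have := len_mul_swap_succ_of_gt hw (i := b) (by omega)
        rw [← hv] at this
        omega
    · rw [if_neg (fun hc => h2 hc.1)]
      have h4 := len_mul_swap_succ_of_gt hyf (i := b) (by rw [hyb, hyb']; omega)
      have h5 := len_mul_swap_succ hw (i := b) (by omega)
      rw [← hv] at h5
      omega

theorem len_mul_swap {w : Perm ℕ} (hw : IsFinitary w) {a b : ℕ} (hab : a < b) (h : w a < w b) :
    len (w * swap a b) = len w + 1 + 2 * ((Finset.Ioo a b).filter
        fun q => w a < w q ∧ w q < w b).card := by
  obtain ⟨d, rfl⟩ : ∃ d, b = a + d + 1 := ⟨b - a - 1, by omega⟩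
  exact len_mul_swap_aux d hw h

theorem len_lt_len_mul_swap_iff {w : Perm ℕ} (hw : IsFinitary w) {a b : ℕ} (hab : a < b) :
    len w < len (w * swap a b) ↔ w a < w b := by
  refine ⟨fun h => ?_, fun h => by rw [len_mul_swap hw hab h]; omega⟩
  by_contra hc
  have hne : w a ≠ w b := fun hc => by have := w.injective hc; omega
  have := len_mul_swap (hw.mul (isFinitary_swap a b)) hab (by simp; omega)
  rw [mul_assoc, swap_mul_self, mul_one] at this
  omega

theorem len_mul_swap_eq_iff {w : Perm ℕ} (hw : IsFinitary w) {a b : ℕ} (hab : a < b) :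
    len (w * swap a b) = len w + 1 ↔
      w a < w b ∧ ∀ q, a < q → q < b → w a < w q → ¬w q < w b := by
  constructor
  · intro h
    have h1 := (len_lt_len_mul_swap_iff hw hab).1 (by omega)
    refine ⟨h1, fun q h2 h3 h4 h5 => ?_⟩
    rw [len_mul_swap hw hab h1] at h
    have : q ∈ (Finset.Ioo a b).filter fun q => w a < w q ∧ w q < w b := by
      simp [h2, h3, h4, h5]
    have := Finset.card_pos.2 ⟨q, this⟩
    omega
  · rintro ⟨h1, h2⟩
    rw [len_mul_swap hw hab h1, Finset.filter_eq_empty_iff.2]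
    · simp
    · intro q hq hc
      exact h2 q (Finset.mem_Ioo.1 hq).1 (Finset.mem_Ioo.1 hq).2 hc.1 hc.2

/-! ### Reduced words and compatible sequences -/

theorem isFinitary_prod_and_len_le (ρ : List ℕ) :
    IsFinitary (ρ.map fun i => swap i (i + 1)).prod ∧
      len (ρ.map fun i => swap i (i + 1)).prod ≤ ρ.length := by
  induction ρ using List.reverseRecOn with
  | nil => simp [isFinitary_one]
  | append_singleton ρ r ih =>
    simp only [List.map_append, List.map_cons, List.map_nil, List.prod_append, List.prod_singleton,
      List.length_append, List.length_singleton]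
    obtain ⟨h1, h2⟩ := ih
    set y := (ρ.map fun i => swap i (i + 1)).prod
    refine ⟨h1.mul (isFinitary_swap _ _), ?_⟩
    rcases lt_trichotomy (y r) (y (r + 1)) with h | h | h
    · rw [len_mul_swap_succ h1 h]
      omega
    · have := y.injective h
      omega
    · have := len_mul_swap_succ_of_gt h1 h
      omega

theorem isReducedWord_nil {w : Perm ℕ} : IsReducedWord w [] ↔ w = 1 := by
  constructor
  · rintro ⟨h, -⟩
    simpa using h.symm
  · rintro rfl
    simp [IsReducedWord]

/-- The last letter of a reduced word must be a descent: at an ascent r, the shorter word would have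
fewer letters than the length of its product. -/
theorem isReducedWord_snoc {w : Perm ℕ} (hw : IsFinitary w) {ρ : List ℕ} {r : ℕ} :
    IsReducedWord w (ρ ++ [r]) ↔ w (r + 1) < w r ∧ IsReducedWord (w * swap r (r + 1)) ρ := by
  simp only [IsReducedWord, List.map_append, List.map_cons, List.map_nil, List.prod_append,
    List.prod_singleton, List.length_append, List.length_singleton]
  have h0 := (isFinitary_prod_and_len_le ρ).2
  constructor
  · rintro ⟨h1, h2⟩
    have h3 : (ρ.map fun i => swap i (i + 1)).prod = w * swap r (r + 1) := by
      rw [← h1, mul_assoc, swap_mul_self, mul_one]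
    rw [h3] at h0
    rcases lt_trichotomy (w r) (w (r + 1)) with h | h | h
    · have := len_mul_swap_succ hw h
      omega
    · have := w.injective h
      omega
    · have := len_mul_swap_succ_of_gt hw h
      exact ⟨h, h3, by omega⟩
  · rintro ⟨h, h1, h2⟩
    have := len_mul_swap_succ_of_gt hw h
    exact ⟨by rw [h1, mul_assoc, swap_mul_self, mul_one], by omega⟩

theorem isCompatible_nil {α : List ℕ} : IsCompatible [] α ↔ α = [] := by
  constructor
  · intro h
    exact List.length_eq_zero_iff.1 h.length_eq
  · rintro rfl
    exact ⟨rfl, fun j h => by simp at h, fun j h => by simp at h, fun j h => by simp at h⟩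

theorem isCompatible_snoc {ρ α : List ℕ} {r a : ℕ} :
    IsCompatible (ρ ++ [r]) (α ++ [a]) ↔ IsCompatible ρ α ∧ a ≤ r ∧
      ∀ r' ∈ ρ.getLast?, ∀ a' ∈ α.getLast?, a' ≤ a ∧ (r' < r → a' < a) := by
  constructor
  · intro h
    have hlen : α.length = ρ.length := by simpa using h.length_eq
    refine ⟨⟨hlen, fun j hj => ?_, fun j hj hlt => ?_, fun j hj => ?_⟩, ?_, ?_⟩
    · have := h.weak j (by simp; omega)
      rwa [List.getElem_append_left (by omega), List.getElem_append_left (by omega)] at this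
    · have := h.strict j (by simp; omega)
      rw [List.getElem_append_left (by omega), List.getElem_append_left (by omega),
        List.getElem_append_left (by omega), List.getElem_append_left (by omega)] at this
      exact this hlt
    · have := h.bound j (by simp; omega)
      rwa [List.getElem_append_left (by omega), List.getElem_append_left (by omega)] at this
    · have := h.bound ρ.length (by simp)
      simpa [List.getElem_append_right, hlen] using this
    · intro r' hr' a' ha'
      rw [Option.mem_def, List.getLast?_eq_getElem?, List.getElem?_eq_some_iff] at hr' ha'
      obtain ⟨h1, rfl⟩ := hr'
      obtain ⟨h2, rfl⟩ := ha'
      have hj : ρ.length - 1 + 1 = ρ.length := by omega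
      have h3 := h.weak (ρ.length - 1) (by simp; omega)
      have h4 := h.strict (ρ.length - 1) (by simp; omega)
      simp only [hj, hlen, List.getElem_append_left h1,
        List.getElem_append_left (show ρ.length - 1 < α.length by omega),
        List.getElem_append_right (le_refl ρ.length), Nat.sub_self, List.getElem_cons_zero,
        List.getElem_append_right (show α.length ≤ ρ.length by omega)] at h3 h4 ⊢
      exact ⟨h3, h4⟩
  · rintro ⟨h, har, hl⟩
    have hlen := h.length_eq
    have hlast : ∀ (j : ℕ) (hj : j < ρ.length), j + 1 = ρ.length →
        α[j] ≤ a ∧ (ρ[j] < r → α[j] < a) := fun j hj hj' => by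
      refine hl _ ?_ _ ?_
      · rw [Option.mem_def, List.getLast?_eq_getElem?, List.getElem?_eq_some_iff]
        exact ⟨by omega, by congr 1; omega⟩
      · rw [Option.mem_def, List.getLast?_eq_getElem?, List.getElem?_eq_some_iff]
        exact ⟨by omega, by congr 1; omega⟩
    refine ⟨by simp [hlen], fun j hj => ?_, fun j hj => ?_, fun j hj => ?_⟩ <;>
      simp only [List.length_append, List.length_singleton] at hj
    · rcases Nat.lt_or_ge (j + 1) ρ.length with h1 | h1
      · rw [List.getElem_append_left (by omega), List.getElem_append_left (by omega)]
        exact h.weak j h1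
      · have h2 : j + 1 = ρ.length := by omega
        rw [List.getElem_append_left (by omega), List.getElem_append_right (by omega)]
        simpa using (hlast j (by omega) h2).1
    · rcases Nat.lt_or_ge (j + 1) ρ.length with h1 | h1
      · rw [List.getElem_append_left (by omega), List.getElem_append_left (by omega),
          List.getElem_append_left (by omega), List.getElem_append_left (by omega)]
        exact h.strict j h1
      · have h2 : j + 1 = ρ.length := by omega
        rw [List.getElem_append_left (by omega), List.getElem_append_right (by omega),
          List.getElem_append_left (by omega), List.getElem_append_right (by omega)]
        simpa using (hlast j (by omega) h2).2
    · rcases Nat.lt_or_ge j ρ.length with h1 | h1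
      · rw [List.getElem_append_left (by omega), List.getElem_append_left (by omega)]
        exact h.bound j h1
      · rw [List.getElem_append_right (by omega), List.getElem_append_right (by omega)]
        simpa using har

theorem IsCompatible.le_of_getLast {ρ α : List ℕ} (h : IsCompatible ρ α) :
    ∀ a ∈ α.getLast?, ∀ a' ∈ α, a' ≤ a := by
  induction ρ using List.reverseRecOn generalizing α with
  | nil =>
    rw [isCompatible_nil] at h
    simp [h]
  | append_singleton ρ r ih =>
    rcases List.eq_nil_or_concat' α with rfl | ⟨α, b, rfl⟩
    · simp
    · obtain ⟨h1, -, h3⟩ := isCompatible_snoc.1 h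
      intro a ha a' ha'
      simp only [List.getLast?_append, List.getLast?_singleton, Option.some_or,
        Option.mem_some_iff] at ha
      subst ha
      rcases List.mem_append.1 ha' with h4 | h4
      · have hα : α ≠ [] := List.ne_nil_of_mem h4
        have hρ : ρ ≠ [] := fun hc => hα (List.length_eq_zero_iff.1 (by simp [h1.length_eq, hc]))
        exact (ih h1 _ (List.getLast?_eq_some_getLast hα) _ h4).trans
          (h3 _ (List.getLast?_eq_some_getLast hρ) _ (List.getLast?_eq_some_getLast hα)).1
      · simp at h4
        omega

/-- The pairs of a reduced word of `w` and a compatible sequence. -/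
def biwords (w : Perm ℕ) : Set (List ℕ × List ℕ) :=
  {p | IsReducedWord w p.1 ∧ IsCompatible p.1 p.2}

/-- Append a letter to each of two words. -/
def snoc (r a : ℕ) (p : List ℕ × List ℕ) : List ℕ × List ℕ := (p.1 ++ [r], p.2 ++ [a])

theorem snoc_injective (r a : ℕ) : Function.Injective (snoc r a) := by
  rintro ⟨ρ, α⟩ ⟨ρ', α'⟩ h
  simpa [snoc] using h

/-- The last letters `r`, `a` of two words satisfy `a < n`, or `a = n` and `j ≤ r`. -/
def LastBefore (n j : ℕ) (p : List ℕ × List ℕ) : Prop :=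
  ∀ r ∈ p.1.getLast?, ∀ a ∈ p.2.getLast?, a < n ∨ (a = n ∧ j ≤ r)

theorem biwords_cases {w : Perm ℕ} {p : List ℕ × List ℕ} (hp : p ∈ biwords w) :
    p = ([], []) ∨ ∃ r a q, p = snoc r a q := by
  obtain ⟨ρ, α⟩ := p
  rcases List.eq_nil_or_concat' ρ with rfl | ⟨ρ, r, rfl⟩
  · left
    exact Prod.ext rfl (isCompatible_nil.1 hp.2)
  · right
    rcases List.eq_nil_or_concat' α with rfl | ⟨α, a, rfl⟩
    · have := hp.2.length_eq
      simp at this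
    · exact ⟨r, a, (ρ, α), rfl⟩

theorem nil_mem_biwords {w : Perm ℕ} : ([], []) ∈ biwords w ↔ w = 1 :=
  ⟨fun h => isReducedWord_nil.1 h.1, fun h => ⟨isReducedWord_nil.2 h, isCompatible_nil.2 rfl⟩⟩

theorem snoc_mem_biwords {w : Perm ℕ} (hw : IsFinitary w) {r a : ℕ} {q : List ℕ × List ℕ} :
    snoc r a q ∈ biwords w ↔ w (r + 1) < w r ∧ q ∈ biwords (w * swap r (r + 1)) ∧ a ≤ r ∧
      ∀ r' ∈ q.1.getLast?, ∀ a' ∈ q.2.getLast?, a' ≤ a ∧ (r' < r → a' < a) := by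
  change IsReducedWord w (q.1 ++ [r]) ∧ IsCompatible (q.1 ++ [r]) (q.2 ++ [a]) ↔ _ ∧ (_ ∧ _) ∧ _
  rw [isReducedWord_snoc hw, isCompatible_snoc]
  tauto

theorem lastBefore_snoc {n j r a : ℕ} {q : List ℕ × List ℕ} :
    LastBefore n j (snoc r a q) ↔ a < n ∨ (a = n ∧ j ≤ r) := by
  simp [LastBefore, snoc]

theorem FixesFrom.lt_of_descent {w : Perm ℕ} {N r : ℕ} (h : FixesFrom w N)
    (hr : w (r + 1) < w r) : r + 1 < N := by
  by_contra hc
  have h1 := h (r + 1) (by omega)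
  by_cases h2 : r < N
  · have := h.apply_lt h2
    omega
  · have := h r (by omega)
    omega

/-- Finiteness allows the `finsum`s over biwords to be split and mapped, and keeps them from taking
their default value 0. -/
theorem finite_biwords {w : Perm ℕ} (hw : IsFinitary w) : (biwords w).Finite := by
  induction hl : len w using Nat.strong_induction_on generalizing w with
  | _ L ih =>
    obtain ⟨N, hN⟩ := (isFinitary_iff w).1 hw
    let I : Set (ℕ × ℕ) := {x | x.1 < N ∧ x.2 < N ∧ w (x.1 + 1) < w x.1}
    have hI : I.Finite := ((Set.finite_lt_nat N).prod (Set.finite_lt_nat N)).subset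
      fun x hx => ⟨hx.1, hx.2.1⟩
    refine ((Set.finite_singleton ([], [])).union (hI.biUnion
      (t := fun x => snoc x.1 x.2 '' biwords (w * swap x.1 (x.1 + 1))) fun x hx => ?_)).subset ?_
    · refine (ih _ ?_ (hw.mul (isFinitary_swap _ _)) rfl).image _
      rw [← hl, len_mul_swap_succ_of_gt hw hx.2.2]
      omega
    · intro p hp
      rcases biwords_cases hp with rfl | ⟨r, a, q, rfl⟩
      · exact Or.inl rfl
      · obtain ⟨h1, h2, h3, -⟩ := (snoc_mem_biwords hw).1 hp
        have := hN.lt_of_descent h1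
        exact Or.inr (Set.mem_biUnion (x := (r, a)) ⟨by simp; omega, by simp; omega, h1⟩ ⟨q, h2, rfl⟩)

/-! ### Interpolation between consecutive truncations -/

/-- The sum of the monomials of the biwords of `w` with `LastBefore n j`. -/
noncomputable def partialSchubert (n j : ℕ) (w : Perm ℕ) : MvPolynomial ℕ ℤ :=
  ∑ᶠ p ∈ {p | p ∈ biwords w ∧ LastBefore n j p}, (p.2.map MvPolynomial.X).prod

theorem partialSchubert_congr {n j n' j' : ℕ} {w : Perm ℕ}
    (h : ∀ p ∈ biwords w, LastBefore n j p ↔ LastBefore n' j' p) :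
    partialSchubert n j w = partialSchubert n' j' w := by
  have : {p | p ∈ biwords w ∧ LastBefore n j p} = {p | p ∈ biwords w ∧ LastBefore n' j' p} :=
    Set.ext fun p => and_congr_right (h p)
  rw [partialSchubert, this, partialSchubert]

-- The difference consists of the biwords ending in (j, n). What precedes such an ending has last
-- letters (r', a') with a' ≤ n, and a' = n forces r' ≥ j; r' = j is excluded since w s_j has an
-- ascent at j. The bound n ≤ j is what makes the ending compatible.
open Classical in
theorem partialSchubert_eq_add {w : Perm ℕ} (hw : IsFinitary w) {n j : ℕ} (hnj : n ≤ j) :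
    partialSchubert n j w = partialSchubert n (j + 1) w +
      MvPolynomial.X n * if w (j + 1) < w j then
        partialSchubert n (j + 1) (w * swap j (j + 1)) else 0 := by
  have hfin : ∀ {v : Perm ℕ}, IsFinitary v → ∀ i,
      {p | p ∈ biwords v ∧ LastBefore n i p}.Finite :=
    fun hv i => (finite_biwords hv).subset fun p hp => hp.1
  have hw' := hw.mul (isFinitary_swap j (j + 1))
  split_ifs with hd
  · have hset : {p | p ∈ biwords w ∧ LastBefore n j p} =
        {p | p ∈ biwords w ∧ LastBefore n (j + 1) p} ∪
          snoc j n '' {p | p ∈ biwords (w * swap j (j + 1)) ∧ LastBefore n (j + 1) p} := by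
      ext p
      constructor
      · rintro ⟨h1, h2⟩
        rcases biwords_cases h1 with rfl | ⟨r, a, q, rfl⟩
        · exact Or.inl ⟨h1, by simp [LastBefore]⟩
        · rw [lastBefore_snoc] at h2
          by_cases hc : a = n ∧ r = j
          · obtain ⟨rfl, rfl⟩ := hc
            obtain ⟨-, h4, -, h6⟩ := (snoc_mem_biwords hw).1 h1
            refine Or.inr ⟨q, ⟨h4, ?_⟩, rfl⟩
            rcases biwords_cases h4 with rfl | ⟨r', a', q', rfl⟩
            · simp [LastBefore]
            · rw [lastBefore_snoc]
              have h7 := h6 r' (by simp [snoc]) a' (by simp [snoc])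
              have h8 := ((snoc_mem_biwords hw').1 h4).1
              have h9 : r' ≠ r := by
                rintro rfl
                simp at h8
                omega
              omega
          · exact Or.inl ⟨h1, lastBefore_snoc.2 (by omega)⟩
      · rintro (⟨h1, h2⟩ | ⟨q, ⟨h1, h2⟩, rfl⟩)
        · exact ⟨h1, fun r hr a ha => by have := h2 r hr a ha; omega⟩
        · refine ⟨(snoc_mem_biwords hw).2 ⟨hd, h1, hnj, fun r' hr' a' ha' => ?_⟩,
            lastBefore_snoc.2 (by omega)⟩
          have := h2 r' hr' a' ha'
          omega
    rw [partialSchubert, hset, finsum_mem_union _ (hfin hw _) ((hfin hw' _).image _),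
      finsum_mem_image (snoc_injective _ _).injOn, ← partialSchubert]
    · congr 1
      rw [partialSchubert, mul_finsum_mem]
      refine finsum_mem_congr rfl fun p _ => ?_
      simp [snoc, mul_comm]
    · rw [Set.disjoint_right]
      rintro _ ⟨q, -, rfl⟩ ⟨-, h⟩
      rw [lastBefore_snoc] at h
      omega
  · rw [mul_zero, add_zero]
    refine partialSchubert_congr fun p hp => ?_
    rcases biwords_cases hp with rfl | ⟨r, a, q, rfl⟩
    · simp [LastBefore]
    · rw [lastBefore_snoc, lastBefore_snoc]
      have : r ≠ j := by
        rintro rfl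
        exact hd ((snoc_mem_biwords hw).1 hp).1
      omega

/-- The truncation of the Schubert polynomial of `w` to `n` variables. -/
noncomputable def truncSchubert (n : ℕ) (w : Perm ℕ) : MvPolynomial ℕ ℤ :=
  truncate n (schubert w)

theorem truncate_prod_X (n : ℕ) (α : List ℕ) (h : ∀ a ∈ α, a < n) :
    truncate n (α.map MvPolynomial.X).prod = (α.map MvPolynomial.X).prod := by
  rw [truncate, map_list_prod, List.map_map]
  congr 1
  refine List.map_congr_left fun a ha => ?_
  simp [h a ha]

theorem truncate_prod_X_eq_zero (n : ℕ) (α : List ℕ) {a : ℕ} (ha : a ∈ α) (h : n ≤ a) :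
    truncate n (α.map MvPolynomial.X).prod = 0 := by
  rw [truncate, map_list_prod, List.map_map]
  refine List.prod_eq_zero (List.mem_map.2 ⟨a, ha, ?_⟩)
  simp [h]

/-- No descent reaches `j`, so the clause a = n, j ≤ r is void; as compatible sequences increase
weakly, bounding the last letter bounds them all. -/
theorem truncSchubert_eq {w : Perm ℕ} {N n j : ℕ} (hN : FixesFrom w N) (hj : N ≤ j + 1) :
    truncSchubert n w = partialSchubert n j w := by
  have hw : IsFinitary w := (isFinitary_iff w).2 ⟨N, hN⟩
  have hiff : ∀ p ∈ biwords w, LastBefore n j p ↔ ∀ a ∈ p.2, a < n := by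
    intro p hp
    rcases biwords_cases hp with rfl | ⟨r, a, q, rfl⟩
    · simp [LastBefore]
    · rw [lastBefore_snoc]
      have := hN.lt_of_descent ((snoc_mem_biwords hw).1 hp).1
      constructor
      · intro h b hb
        have := hp.2.le_of_getLast a (by simp [snoc]) b hb
        omega
      · intro h
        exact Or.inl (h a (by simp [snoc]))
  have h0 : truncSchubert n w =
      ∑ᶠ p ∈ biwords w, truncate n (p.2.map MvPolynomial.X).prod :=
    (MvPolynomial.aeval (R := ℤ) (S₁ := MvPolynomial ℕ ℤ) (fun i : ℕ => if i < n then
      MvPolynomial.X i else 0)).toRingHom.toAddMonoidHom.map_finsum_mem _ (finite_biwords hw)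
  rw [h0, partialSchubert]
  trans ∑ᶠ p ∈ {p | p ∈ biwords w ∧ LastBefore n j p}, truncate n (p.2.map MvPolynomial.X).prod
  · refine finsum_mem_inter_support_eq _ _ _ (Set.ext fun p => ?_)
    refine and_congr_left fun hs => ⟨fun hp => ⟨hp, (hiff p hp).2 fun a ha => ?_⟩, fun hp => hp.1⟩
    by_contra hc
    exact hs (truncate_prod_X_eq_zero n p.2 ha (not_lt.1 hc))
  · exact finsum_mem_congr rfl fun p hp => truncate_prod_X n p.2 ((hiff p hp.1).1 hp.2)

/-- The other end of the interpolation: compatibility gives a ≤ r, so a = n already implies n ≤ r.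
-/
theorem partialSchubert_self (n : ℕ) {w : Perm ℕ} {N : ℕ} (hN : FixesFrom w N) :
    partialSchubert n n w = truncSchubert (n + 1) w := by
  have hw : IsFinitary w := (isFinitary_iff w).2 ⟨N, hN⟩
  rw [truncSchubert_eq hN (j := N) (by omega)]
  refine partialSchubert_congr fun p hp => ?_
  rcases biwords_cases hp with rfl | ⟨r, a, q, rfl⟩
  · simp [LastBefore]
  · rw [lastBefore_snoc, lastBefore_snoc]
    obtain ⟨h1, -, h3, -⟩ := (snoc_mem_biwords hw).1 hp
    have := hN.lt_of_descent h1
    omega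

/-! ### Cases in which the truncation is the whole polynomial or zero -/

/-- `w` is increasing from position `n` on. -/
def IncreasingFrom (w : Perm ℕ) (n : ℕ) : Prop := ∀ i, n ≤ i → w i < w (i + 1)

theorem IncreasingFrom.lt {w : Perm ℕ} {n : ℕ} (h : IncreasingFrom w n) {i j : ℕ} (hi : n ≤ i)
    (hij : i < j) : w i < w j := by
  induction j, hij using Nat.le_induction with
  | base => exact h i hi
  | succ j hj ih => exact ih.trans (h j (by omega))

/-- The last compatible letter is the largest, and it is at most the last letter of the reduced
word, a descent, hence below `n`. -/
theorem lt_of_mem_biwords {w : Perm ℕ} (hw : IsFinitary w) {n : ℕ} (h : IncreasingFrom w n)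
    {p : List ℕ × List ℕ} (hp : p ∈ biwords w) : ∀ a ∈ p.2, a < n := by
  rcases biwords_cases hp with rfl | ⟨r, a, q, rfl⟩
  · simp
  · obtain ⟨h1, -, h3, -⟩ := (snoc_mem_biwords hw).1 hp
    have h4 : r < n := by
      by_contra hc
      have := h r (by omega)
      omega
    intro b hb
    have := hp.2.le_of_getLast a (by simp [snoc]) b hb
    omega

theorem truncSchubert_of_increasingFrom {w : Perm ℕ} (hw : IsFinitary w) {n : ℕ}
    (h : IncreasingFrom w n) : truncSchubert n w = schubert w := by
  have h0 : truncSchubert n w =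
      ∑ᶠ p ∈ biwords w, truncate n (p.2.map MvPolynomial.X).prod :=
    (MvPolynomial.aeval (R := ℤ) (S₁ := MvPolynomial ℕ ℤ) (fun i : ℕ => if i < n then
      MvPolynomial.X i else 0)).toRingHom.toAddMonoidHom.map_finsum_mem _ (finite_biwords hw)
  rw [h0]
  exact finsum_mem_congr rfl fun p hp => truncate_prod_X n p.2 (lt_of_mem_biwords hw h hp)

theorem truncSchubert_zero {w : Perm ℕ} (hw : IsFinitary w) (h : w ≠ 1) :
    truncSchubert 0 w = 0 := by
  obtain ⟨N, hN⟩ := (isFinitary_iff w).1 hw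
  rw [truncSchubert_eq hN (j := N) (by omega), partialSchubert]
  have : {p | p ∈ biwords w ∧ LastBefore 0 N p} = ∅ := by
    refine Set.eq_empty_of_forall_notMem ?_
    rintro p ⟨h1, h2⟩
    rcases biwords_cases h1 with rfl | ⟨r, a, q, rfl⟩
    · exact h (nil_mem_biwords.1 h1)
    · rw [lastBefore_snoc] at h2
      have := hN.lt_of_descent ((snoc_mem_biwords hw).1 h1).1
      omega
  rw [this, finsum_mem_empty]

/-! ### Monk's rule for truncated Schubert polynomials -/

section Monk

variable {R : Type*} [CommRing R]

open Classical in
/-- The signed sum of the values of `F` at the covers `v (p, b)` of `v` with `b ≤ K`. -/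
noncomputable def monk (K : ℕ) (F : Perm ℕ → R) (p : ℕ) (v : Perm ℕ) : R :=
  -- For v fixing all i ≥ K and p < K this range misses no cover: if b > K, position K lies between
  -- p and b, and its value K lies between v p and v b = b.
  ∑ b ∈ Finset.range (K + 1), if len (v * swap p b) = len v + 1 then
    (if p < b then F (v * swap p b) else -F (v * swap p b)) else 0

theorem monk_congr {K : ℕ} {F G : Perm ℕ → R} {p : ℕ} {v : Perm ℕ}
    (h : ∀ b ≤ K, len (v * swap p b) = len v + 1 → F (v * swap p b) = G (v * swap p b)) :
    monk K F p v = monk K G p v := by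
  refine Finset.sum_congr rfl fun b hb => ?_
  split_ifs with h1
  · rw [h b (by simp at hb; omega) h1]
  · rw [h b (by simp at hb; omega) h1]
  · rfl

theorem monk_add_mul (K : ℕ) (F G : Perm ℕ → R) (x : R) (p : ℕ) (v : Perm ℕ) :
    monk K (fun y => F y + x * G y) p v = monk K F p v + x * monk K G p v := by
  simp only [monk, Finset.mul_sum, ← Finset.sum_add_distrib]
  refine Finset.sum_congr rfl fun b _ => ?_
  split_ifs <;> ring

/-- Conjugation by s_j keeps the order of the two exchanged positions unless they are j and j+1, so
both sides compare the same two values of v. -/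
theorem len_lt_len_mul_swap_swap_succ_iff {v : Perm ℕ} (hv : IsFinitary v) {j p b : ℕ}
    (hpb : p ≠ b) (h1 : ¬(p = j ∧ b = j + 1)) (h2 : ¬(b = j ∧ p = j + 1)) :
    len v < len (v * swap p b) ↔
      len (v * swap j (j + 1)) < len (v * swap p b * swap j (j + 1)) := by
  have hvs := hv.mul (isFinitary_swap j (j + 1))
  have aux : ∀ {a c : ℕ}, a < c → ¬(a = j ∧ c = j + 1) → (len v < len (v * swap a c) ↔
      len (v * swap j (j + 1)) < len (v * swap a c * swap j (j + 1))) := by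
    intro a c hac h
    have h3 : v * swap a c * swap j (j + 1) =
        v * swap j (j + 1) * swap (swap j (j + 1) a) (swap j (j + 1) c) := by
      rw [mul_assoc, mul_assoc, mul_swap_eq_swap_mul (swap j (j + 1))]
      simp
    rw [h3, len_lt_len_mul_swap_iff hv hac,
      len_lt_len_mul_swap_iff hvs (swap_succ_lt_swap_succ hac h)]
    simp
  rcases lt_or_gt_of_ne hpb with h | h
  · exact aux h h1
  · rw [swap_comm]
    exact aux h h2

-- Reindexing b by s_j turns the covers of v s_j into the permutations v t_{pb} s_j, and the two
-- sides then agree term by term. The exceptions are {p, b} = {j, j+1}, where v t_{pb} s_j = v; they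
-- produce the two corrections. The bound j < K lets s_j permute the summation range.
open Classical in
theorem monk_descent {K j : ℕ} (hj : j < K) (F : Perm ℕ → R) {p : ℕ} (hp : p ≤ K) {v : Perm ℕ}
    (hv : IsFinitary v) :
    monk K (fun y => if y (j + 1) < y j then F (y * swap j (j + 1)) else 0) p v =
      (if v (j + 1) < v j then monk K F (swap j (j + 1) p) (v * swap j (j + 1)) else 0) +
        (if p = j then F v else 0) - (if p = j + 1 then F v else 0) := by
  set s := swap j (j + 1) with hs
  have hvs := hv.mul (isFinitary_swap j (j + 1))
  have hsj : s j = j + 1 := by simp [hs]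
  have hsj' : s (j + 1) = j := by simp [hs]
  have hdesc : ∀ {y : Perm ℕ}, IsFinitary y →
      (y j < y (j + 1) ∧ len (y * s) = len y + 1) ∨
        (y (j + 1) < y j ∧ len y = len (y * s) + 1) := by
    intro y hy
    rcases lt_trichotomy (y j) (y (j + 1)) with h | h | h
    · exact Or.inl ⟨h, len_mul_swap_succ hy h⟩
    · have := y.injective h
      omega
    · exact Or.inr ⟨h, len_mul_swap_succ_of_gt hy h⟩
  have hR : monk K F (s p) (v * s) = ∑ b ∈ Finset.range (K + 1),
      if len (v * swap p b * s) = len (v * s) + 1 then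
        (if s p < s b then F (v * swap p b * s) else -F (v * swap p b * s)) else 0 := by
    rw [monk, ← Equiv.Perm.sum_comp s]
    · refine Finset.sum_congr rfl fun b _ => ?_
      have : v * s * swap (s p) (s b) = v * swap p b * s := by
        rw [mul_assoc, mul_assoc, mul_swap_eq_swap_mul s]
        simp [hs]
      rw [this]
    · intro x hx
      by_contra hc
      refine hx (swap_apply_of_ne_of_ne ?_ ?_) <;> simp at hc <;> omega
  have hδ : (if p = j then F v else 0) - (if p = j + 1 then F v else 0) =
      ∑ b ∈ Finset.range (K + 1), ((if p = j ∧ b = j + 1 then F v else 0) -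
        (if p = j + 1 ∧ b = j then F v else 0)) := by
    rw [Finset.sum_sub_distrib]
    congr 1
    · by_cases h : p = j
      · simp [h, hj]
      · simp [h]
    · by_cases h : p = j + 1
      · simp [h, hj.le]
      · simp [h]
  have hR' : (if v (j + 1) < v j then monk K F (s p) (v * s) else 0) =
      ∑ b ∈ Finset.range (K + 1), if v (j + 1) < v j then
        (if len (v * swap p b * s) = len (v * s) + 1 then
          (if s p < s b then F (v * swap p b * s) else -F (v * swap p b * s)) else 0) else 0 := by
    split_ifs with h
    · exact hR
    · simp
  rw [add_sub_assoc, hδ, hR', ← Finset.sum_add_distrib, monk]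
  refine Finset.sum_congr rfl fun b _ => ?_
  have hvv := hdesc hv
  by_cases hpb : p = b
  · subst hpb
    have h1 : ¬(p = j ∧ p = j + 1) := by omega
    have h2 : ¬(p = j + 1 ∧ p = j) := by omega
    have h3 : v * swap p p = v := by
      rw [swap_self]
      rfl
    simp only [h3]
    simp [h1, h2]
  by_cases h1 : p = j ∧ b = j + 1
  · obtain ⟨rfl, rfl⟩ := h1
    rw [← hs]
    have h3 : v * s * s = v := by rw [mul_assoc, hs, swap_mul_self, mul_one]
    rw [h3, hsj, hsj', Perm.mul_apply, Perm.mul_apply, hsj, hsj']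
    rcases hvv with ⟨h4, h5⟩ | ⟨h4, h5⟩
    · simp [h4, h5, h4.not_gt]
    · have : ¬ (len (v * s) = len v + 1) := by omega
      simp [h4, ← h5, this]
  by_cases h2 : b = j ∧ p = j + 1
  · obtain ⟨rfl, rfl⟩ := h2
    rw [swap_comm (b + 1) b, ← hs]
    have h3 : v * s * s = v := by rw [mul_assoc, hs, swap_mul_self, mul_one]
    rw [h3, hsj, hsj', Perm.mul_apply, Perm.mul_apply, hsj, hsj']
    rcases hvv with ⟨h4, h5⟩ | ⟨h4, h5⟩
    · simp [h4, h5, h4.not_gt]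
    · have : ¬ (len (v * s) = len v + 1) := by omega
      simp [h4, ← h5, this]
  have h2' : ¬(p = j + 1 ∧ b = j) := fun h => h2 h.symm
  have hlt : p < b ↔ s p < s b := by
    constructor
    · intro h
      exact swap_succ_lt_swap_succ h h1
    · intro h
      by_contra hc
      have := swap_succ_lt_swap_succ (i := j) (lt_of_le_of_ne (not_lt.1 hc) (Ne.symm hpb)) h2
      rw [← hs] at this
      omega
  have hlen := len_lt_len_mul_swap_swap_succ_iff hv hpb h1 h2
  rw [← hs] at hlen
  have hAA := hdesc (hv.mul (isFinitary_swap p b))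
  rw [if_neg h1, if_neg h2', sub_zero, add_zero]
  simp only [hlt]
  split_ifs <;> first | rfl | exact neg_zero | (exfalso; omega)

end Monk

/-- Descending induction on `j`, one factor of x_n at a time. In the intermediate stages the
multiplier x_n sits at position `j`; the corrections of `monk_descent` move it from j+1 to j, and at
j = n it has become x_p for p = n. -/
theorem monk_partialSchubert {n K : ℕ}
    (ih : ∀ v : Perm ℕ, FixesFrom v K → ∀ p < K, monk K (truncSchubert n) p v =
      (if p < n then MvPolynomial.X p else 0) * truncSchubert n v) {j : ℕ} (hj : j ≤ K)
    (hnj : n ≤ j) : ∀ v : Perm ℕ, FixesFrom v K → ∀ p < K,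
      monk K (partialSchubert n j) p v =
        (if p < n then MvPolynomial.X p else if p = j then MvPolynomial.X n else 0) *
          partialSchubert n j v := by
  induction hj using Nat.decreasingInduction with
  | self =>
    intro v hv p hp
    rw [if_neg (show p ≠ K by omega), ← truncSchubert_eq hv (by omega), ← ih v hv p hp]
    -- A cover with b = K may move K, so it is only known to fix the integers from K+1 on; this is
    -- why `truncSchubert_eq` asks only N ≤ j + 1.
    refine monk_congr fun b hb _ => ?_
    rw [truncSchubert_eq (N := K + 1) _ le_rfl]
    exact (hv.mono (by omega)).mul_swap (by omega) (by omega)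
  | of_succ j hj ihj =>
    intro v hv p hp
    have ihj := ihj (by omega)
    have hvf : IsFinitary v := (isFinitary_iff v).2 ⟨K, hv⟩
    have h1 : monk K (partialSchubert n j) p v = monk K (partialSchubert n (j + 1)) p v +
        MvPolynomial.X n * monk K (fun y => if y (j + 1) < y j then
          partialSchubert n (j + 1) (y * swap j (j + 1)) else 0) p v := by
      rw [← monk_add_mul]
      exact monk_congr fun b _ _ => partialSchubert_eq_add (hvf.mul (isFinitary_swap _ _)) hnj
    have h2 := ihj v hv p hp
    have h3 : (if v (j + 1) < v j then monk K (partialSchubert n (j + 1)) (swap j (j + 1) p)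
          (v * swap j (j + 1)) else 0) = (if swap j (j + 1) p < n then MvPolynomial.X
            (swap j (j + 1) p) else if swap j (j + 1) p = j + 1 then MvPolynomial.X n else 0) *
          if v (j + 1) < v j then partialSchubert n (j + 1) (v * swap j (j + 1)) else 0 := by
      by_cases hd : v (j + 1) < v j
      · have hjK := hv.lt_of_descent hd
        have h4 : FixesFrom (swap j (j + 1)) K := fixesFrom_swap (by omega) (by omega)
        rw [if_pos hd, if_pos hd]
        exact ihj _ (hv.mul h4) _ (h4.apply_lt hp)
      · rw [if_neg hd, if_neg hd, mul_zero]
    rw [h1, monk_descent (by omega) _ hp.le hvf, h2, h3, partialSchubert_eq_add hvf hnj]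
    by_cases hpj : p = j
    · subst hpj
      rw [swap_apply_left]
      have h5 : ¬ p < n := by omega
      have h6 : ¬ p + 1 < n := by omega
      simp only [h5, h6, if_false, if_true, show p ≠ p + 1 by omega]
      ring
    by_cases hpj' : p = j + 1
    · subst hpj'
      rw [swap_apply_right]
      have h5 : ¬ j < n := by omega
      have h6 : ¬ j + 1 < n := by omega
      simp only [h5, h6, if_false, if_true, show j ≠ j + 1 by omega, show j + 1 ≠ j by omega]
      ring
    · rw [swap_apply_of_ne_of_ne hpj hpj']
      simp only [hpj, hpj', if_false]
      ring

/-- Monk's rule after truncation to `n` variables. -/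
theorem monk_truncSchubert (n : ℕ) : ∀ {K : ℕ}, n ≤ K → ∀ v : Perm ℕ, FixesFrom v K → ∀ p < K,
    monk K (truncSchubert n) p v =
      (if p < n then MvPolynomial.X p else 0) * truncSchubert n v := by
  induction n with
  | zero =>
    intro K _ v hv p hp
    have hvf : IsFinitary v := (isFinitary_iff v).2 ⟨K, hv⟩
    rw [if_neg (by omega), zero_mul, monk]
    -- A cover has positive length, so it is not the identity and nothing of it survives without
    -- variables.
    refine Finset.sum_eq_zero fun b _ => ?_
    split_ifs with h1
    all_goals first
      | rfl
      | rw [truncSchubert_zero (hvf.mul (isFinitary_swap p b)) fun hc => by simp [hc] at h1]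
        try rw [neg_zero]
  | succ n ih =>
    intro K hK v hv p hp
    have hvf : IsFinitary v := (isFinitary_iff v).2 ⟨K, hv⟩
    have h := monk_partialSchubert (fun v hv p hp => ih (by omega) v hv p hp)
      (show n ≤ K by omega) le_rfl v hv p hp
    rw [partialSchubert_self n hv] at h
    rw [← monk_congr (F := partialSchubert n n), h]
    · congr 1
      by_cases h1 : p < n
      · rw [if_pos h1, if_pos (by omega)]
      · by_cases h2 : p = n
        · subst h2
          simp
        · rw [if_neg h1, if_neg h2, if_neg (by omega)]
    · intro b hb _
      exact partialSchubert_self n (N := K + 1)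
        ((hv.mono (by omega)).mul_swap (by omega) (by omega))

/-! ### Chains of transpositions -/

/-- The permutation `v (A_0, k) (A_1, k+1) ⋯ (A_{j-1}, k+j-1)`. -/
def chain (v : Perm ℕ) (k : ℕ) (A : ℕ → ℕ) : ℕ → Perm ℕ
  | 0 => v
  | j + 1 => chain v k A j * swap (A j) (k + j)

theorem chain_congr {v : Perm ℕ} {k : ℕ} {A B : ℕ → ℕ} {j : ℕ} (h : ∀ i < j, A i = B i) :
    chain v k A j = chain v k B j := by
  induction j with
  | zero => rfl
  | succ j ih => rw [chain, chain, ih fun i hi => h i (by omega), h j (by omega)]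

theorem isFinitary_chain {v : Perm ℕ} (hv : IsFinitary v) (k : ℕ) (A : ℕ → ℕ) (j : ℕ) :
    IsFinitary (chain v k A j) := by
  induction j with
  | zero => exact hv
  | succ j ih => exact ih.mul (isFinitary_swap _ _)

theorem chain_mul_swap {y : Perm ℕ} {k i n j : ℕ} {A : ℕ → ℕ} (hi : i < k) (hjn : j ≤ n)
    (hA : ∀ l < j, A l < k ∧ A l ≠ i) :
    chain (y * swap i (k + n)) k A j = chain y k A j * swap i (k + n) := by
  induction j with
  | zero => rfl
  | succ j ih =>
    have h1 := hA j (by omega)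
    rw [chain, chain, ih (by omega) fun l hl => hA l (by omega), mul_assoc, mul_assoc]
    congr 1
    refine (Perm.Disjoint.commute (fun x => ?_)).eq
    by_cases hx : x = i ∨ x = k + n
    · exact Or.inr (swap_apply_of_ne_of_ne (by omega) (by omega))
    · exact Or.inl (swap_apply_of_ne_of_ne (by omega) (by omega))

/-- Consecutive transpositions with a common first position `i`, at the end of a chain, may be
applied at its beginning. -/
theorem chain_eq_chain_of_const {v : Perm ℕ} {k i l n : ℕ} {A : ℕ → ℕ} (hi : i < k)
    (hA : ∀ j < l, A j < k ∧ A j ≠ i) (hA' : ∀ j, l ≤ j → j < n → A j = i) (hln : l < n) :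
    ∀ y : Perm ℕ, y i = v (k + n - 1) → y (k + l) = v i →
      (∀ x, k + l < x → x < k + n → y x = v (x - 1)) →
      (∀ x, x ≠ i → x < k + l ∨ k + n ≤ x → y x = v x) → chain v k A n = chain y k A l := by
  induction n, hln using Nat.le_induction with
  | base =>
    intro y h1 h2 h3 h4
    have : y = v * swap i (k + l) := by
      ext x
      rw [Perm.mul_apply]
      by_cases hx : x = i
      · rw [hx, swap_apply_left, h1]
        rfl
      by_cases hx' : x = k + l
      · rw [hx', swap_apply_right, h2]
      · rw [swap_apply_of_ne_of_ne hx hx', h4 x hx (by omega)]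
    rw [chain, hA' l le_rfl (by omega), this, chain_mul_swap hi le_rfl hA]
  | succ n hn ih =>
    intro y h1 h2 h3 h4
    -- Undoing the last transposition of the run turns the starting point for n+1 into the one for
    -- n; it commutes with the first `l` steps, whose positions are different.
    have h5 := ih (fun j hj hj' => hA' j hj (by omega)) (y * swap i (k + n)) ?_ ?_ ?_ ?_
    · rw [chain, h5, hA' n (by omega) (by omega), chain_mul_swap hi (by omega) hA, mul_assoc,
        swap_mul_self, mul_one]
    · rw [Perm.mul_apply, swap_apply_left]
      exact h3 _ (by omega) (by omega)
    · rw [Perm.mul_apply, swap_apply_of_ne_of_ne (by omega) (by omega), h2]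
    · intro x hx hx'
      rw [Perm.mul_apply, swap_apply_of_ne_of_ne (by omega) (by omega), h3 x hx (by omega)]
    · intro x hx hx'
      rw [Perm.mul_apply]
      by_cases hxn : x = k + n
      · rw [hxn, swap_apply_right, h1]
        rfl
      · rw [swap_apply_of_ne_of_ne hx hxn, h4 x hx (by omega)]

/-! ### Admissible sequences: covers read from the initial permutation -/

/-- A description, in terms of `v` only, of when the `j`-th transposition of a chain is a cover. -/
def IsAdmissible (v : Perm ℕ) (k : ℕ) (A : ℕ → ℕ) (j : ℕ) : Prop :=
  (v (A j) < v (k + j) ∧ (∀ i, j = i + 1 → v (k + i) < v (A j)) ∧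
    ∀ q, A j < q → q < k → v (A j) < v q → ¬v q < v (k + j)) ∨
  ∃ i, j = i + 1 ∧ A j = A i ∧ ∀ q, A j < q → q < k → v (k + i) < v q → ¬v q < v (k + j)

/-- Properties of the partial products of a chain of covers. -/
structure ChainInvariant (v : Perm ℕ) (k : ℕ) (A : ℕ → ℕ) (j : ℕ) : Prop where
  increasing : IncreasingFrom (chain v k A j) k
  right : ∀ l, j ≤ l → chain v k A j (k + l) = v (k + l)
  left : ∀ q < k, chain v k A j q = v q ∨
    ∃ i, j = i + 1 ∧ v q < v (k + i) ∧ chain v k A j q ≤ v (k + i)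
  last : ∀ i, j = i + 1 → chain v k A j (A i) = v (k + i)
  bound : ∀ i, j = i + 1 → ∀ l ≤ i, chain v k A j (k + l) < v (k + i)

theorem ne_of_ne (v : Perm ℕ) {a b : ℕ} (h : a ≠ b) : v a ≠ v b := fun hc => h (v.injective hc)

theorem chainInvariant {v : Perm ℕ} (hv : IsFinitary v) {k : ℕ} (hinc : IncreasingFrom v k)
    {A : ℕ → ℕ} {j : ℕ} (hA : ∀ i < j, A i < k)
    (hcov : ∀ i < j, len (chain v k A (i + 1)) = len (chain v k A i) + 1) :
    ChainInvariant v k A j := by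
  induction j with
  | zero =>
    exact ⟨hinc, fun _ _ => rfl, fun _ _ => Or.inl rfl, fun i hi => by omega,
      fun i hi => by omega⟩
  | succ j ih =>
    have I := ih (fun i hi => hA i (by omega)) fun i hi => hcov i (by omega)
    have hAj := hA j (by omega)
    have hc := hcov j (by omega)
    rw [chain, len_mul_swap_eq_iff (isFinitary_chain hv k A j) (by omega), I.right j le_rfl] at hc
    obtain ⟨hc1, hc2⟩ := hc
    have e1 : chain v k A (j + 1) (A j) = v (k + j) := by
      rw [chain, Perm.mul_apply, swap_apply_left, I.right j le_rfl]
    have e2 : chain v k A (j + 1) (k + j) = chain v k A j (A j) := by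
      rw [chain, Perm.mul_apply, swap_apply_right]
    have e3 : ∀ x, x ≠ A j → x ≠ k + j → chain v k A (j + 1) x = chain v k A j x := by
      intro x h1 h2
      rw [chain, Perm.mul_apply, swap_apply_of_ne_of_ne h1 h2]
    have hinc' : IncreasingFrom (chain v k A (j + 1)) k := by
      intro x hx
      by_cases h1 : x = k + j
      · subst h1
        rw [e2, e3 _ (by omega) (by omega), add_assoc, I.right (j + 1) (by omega)]
        exact hc1.trans (hinc _ (by omega))
      · rw [e3 x (by omega) h1]
        by_cases h2 : x + 1 = k + j
        · rw [h2, e2]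
          have h3 := I.increasing x hx
          rw [h2, I.right j le_rfl] at h3
          -- Position k+j-1 lies inside the exchanged interval and its value is below the upper one,
          -- so the cover condition puts it below the lower one.
          have h4 := hc2 x (by omega) (by omega)
          have h5 := ne_of_ne (chain v k A j) (show x ≠ A j by omega)
          omega
        · rw [e3 _ (by omega) h2]
          exact I.increasing x hx
    refine ⟨hinc', fun l hl => ?_, fun q hq => ?_, fun i hi => ?_, fun i hi l hl => ?_⟩
    · rw [e3 _ (by omega) (by omega)]
      exact I.right l (by omega)
    · by_cases h1 : q = A j
      · subst h1
        refine Or.inr ⟨j, rfl, ?_, e1.le⟩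
        rcases I.left _ hAj with h2 | ⟨i, h2, h3, -⟩
        · omega
        · exact h3.trans (hinc.lt (by omega) (by omega))
      · rw [e3 q h1 (by omega)]
        rcases I.left q hq with h2 | ⟨i, h2, h3, h4⟩
        · exact Or.inl h2
        · have := hinc.lt (show k ≤ k + i by omega) (show k + i < k + j by omega)
          exact Or.inr ⟨j, rfl, by omega, by omega⟩
    · obtain rfl : j = i := by omega
      exact e1
    · obtain rfl : j = i := by omega
      rcases hl.lt_or_eq with h1 | rfl
      · have := hinc'.lt (show k ≤ k + l by omega) (show k + l < k + j by omega)
        rw [e2] at this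
        omega
      · rw [e2]
        exact hc1

/-- After step j-1 the value v(k+j-1) sits in position A(j-1), and every changed position left of k
has a value at most that. So step j either raises this same entry again or uses an untouched entry
whose value lies between v(k+j-1) and v(k+j). Only untouched entries can then obstruct the cover. -/
theorem len_chain_succ_iff {v : Perm ℕ} (hv : IsFinitary v) {k : ℕ} (hinc : IncreasingFrom v k)
    {A : ℕ → ℕ} {j : ℕ} (hA : ∀ i ≤ j, A i < k)
    (hcov : ∀ i < j, len (chain v k A (i + 1)) = len (chain v k A i) + 1) :
    len (chain v k A (j + 1)) = len (chain v k A j) + 1 ↔ IsAdmissible v k A j := by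
  have I := chainInvariant hv hinc (fun i hi => hA i hi.le) hcov
  have hAj := hA j le_rfl
  rw [chain, len_mul_swap_eq_iff (isFinitary_chain hv k A j) (by omega), I.right j le_rfl]
  set y := chain v k A j with hy
  have hleft : ∀ q < k, y q = v q ∨ ∃ i, j = i + 1 ∧ v q < v (k + i) ∧ y q ≤ v (k + i) := I.left
  have hlast : ∀ i, j = i + 1 → y (A i) = v (k + i) := I.last
  have hbound : ∀ i, j = i + 1 → ∀ l ≤ i, y (k + l) < v (k + i) := I.bound
  have hjlt : ∀ i, j = i + 1 → v (k + i) < v (k + j) := fun i hi =>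
    hinc.lt (by omega) (by omega)
  constructor
  · rintro ⟨h1, h2⟩
    rcases Nat.eq_zero_or_pos j with h0 | h0
    · subst h0
      exact Or.inl ⟨h1, fun i hi => by omega, fun q h3 h4 => h2 q h3 (by omega)⟩
    · obtain ⟨i, rfl⟩ : ∃ i, j = i + 1 := ⟨j - 1, by omega⟩
      have hlt := hjlt i rfl
      have hbig : ∀ q < k, v (k + i) < v q → y q = v q := by
        intro q hq h3
        rcases hleft q hq with h4 | ⟨i', h4, h5, -⟩
        · exact h4
        · obtain rfl : i = i' := by omega
          omega
      by_cases hAA : A (i + 1) = A i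
      · refine Or.inr ⟨i, rfl, hAA, fun q h3 h4 h5 => ?_⟩
        have h6 := h2 q h3 (by omega)
        rw [hbig q h4 h5, hAA, hlast i rfl] at h6
        exact h6 h5
      · have hc := hcov i (by omega)
        have I' := chainInvariant hv hinc (j := i) (fun l hl => hA l (by omega))
          fun l hl => hcov l (by omega)
        have hAi := hA i (by omega)
        rw [chain, len_mul_swap_eq_iff (isFinitary_chain hv k A i) (by omega),
          I'.right i le_rfl] at hc
        obtain ⟨-, hc2⟩ := hc
        have e1 : y (k + i) = chain v k A i (A i) := by
          rw [hy, chain, Perm.mul_apply, swap_apply_right]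
        have e2 : y (A (i + 1)) = chain v k A i (A (i + 1)) := by
          rw [hy, chain, Perm.mul_apply, swap_apply_of_ne_of_ne hAA (by omega)]
        have h3 := h2 (k + i) (by omega) (by omega)
        have h4 := hbound i rfl i le_rfl
        have h5 := hlast i rfl
        have h6 := ne_of_ne y (show A (i + 1) ≠ k + i by omega)
        have h7 := ne_of_ne y hAA
        -- Otherwise a cover condition fails. If the new position is left of A i, the value v(k+i)
        -- now in A i obstructs the present step. If it is right of A i, the present step forces its
        -- value above the one in k+i, and it then obstructed the preceding step.
        have h8 : v (k + i) < y (A (i + 1)) := by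
          rcases lt_or_gt_of_ne hAA with h9 | h9
          · have := h2 (A i) h9 (by omega)
            omega
          · have := hc2 (A (i + 1)) h9 (by omega)
            omega
        have h9 : y (A (i + 1)) = v (A (i + 1)) := by
          rcases hleft _ hAj with h4 | ⟨i', h4, -, h5⟩
          · exact h4
          · obtain rfl : i = i' := by omega
            omega
        rw [h9] at h1 h8 h2
        refine Or.inl ⟨h1, fun i' hi' => ?_, fun q h10 h11 h12 => ?_⟩
        · obtain rfl : i = i' := by omega
          exact h8
        · have h13 := h2 q h10 (by omega)
          rw [hbig q h11 (by omega)] at h13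
          exact h13 h12
  · rintro (⟨h1, h2, h3⟩ | ⟨i, rfl, h1, h2⟩)
    · have h4 : y (A j) = v (A j) := by
        rcases hleft _ hAj with h4 | ⟨i, h4, h5, -⟩
        · exact h4
        · have := h2 i h4
          omega
      rw [h4]
      refine ⟨h1, fun q h5 h6 h7 => ?_⟩
      by_cases hq : q < k
      · rcases hleft q hq with h8 | ⟨i, h8, h9, h10⟩
        · rw [h8] at h7 ⊢
          exact h3 q h5 hq h7
        · have := h2 i h8
          omega
      · obtain ⟨l, rfl⟩ : ∃ l, q = k + l := ⟨q - k, by omega⟩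
        obtain ⟨i, rfl⟩ : ∃ i, j = i + 1 := ⟨j - 1, by omega⟩
        have := hbound i rfl l (by omega)
        have := h2 i rfl
        omega
    · have hlt := hjlt i rfl
      have h4 : y (A (i + 1)) = v (k + i) := by rw [h1, hlast i rfl]
      rw [h4]
      refine ⟨hlt, fun q h5 h6 h7 => ?_⟩
      by_cases hq : q < k
      · rcases hleft q hq with h8 | ⟨i', h8, h9, h10⟩
        · rw [h8] at h7 ⊢
          exact h2 q h5 hq h7
        · obtain rfl : i = i' := by omega
          omega
      · obtain ⟨l, rfl⟩ : ∃ l, q = k + l := ⟨q - k, by omega⟩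
        have := hbound i rfl l (by omega)
        omega

theorem forall_len_chain_succ_iff {v : Perm ℕ} (hv : IsFinitary v) {k : ℕ}
    (hinc : IncreasingFrom v k) {A : ℕ → ℕ} {m : ℕ} (hA : ∀ i < m, A i < k) :
    (∀ j < m, len (chain v k A (j + 1)) = len (chain v k A j) + 1) ↔
      ∀ j < m, IsAdmissible v k A j := by
  induction m with
  | zero => simp
  | succ m ih =>
    have ih := ih fun i hi => hA i (by omega)
    constructor
    · intro h j hj
      exact (len_chain_succ_iff hv hinc (fun i hi => hA i (by omega))
        fun i hi => h i (by omega)).1 (h j hj)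
    · intro h j hj
      have h1 := ih.2 fun i hi => h i (by omega)
      rcases Nat.lt_succ_iff_lt_or_eq.1 hj with h2 | rfl
      · exact h1 j h2
      · exact (len_chain_succ_iff hv hinc (fun i hi => hA i (by omega)) h1).2 (h j hj)

theorem IsAdmissible.congr {v : Perm ℕ} {k : ℕ} {A B : ℕ → ℕ} {j : ℕ} (h : ∀ i ≤ j, A i = B i)
    (hA : IsAdmissible v k A j) : IsAdmissible v k B j := by
  unfold IsAdmissible at hA ⊢
  rw [← h j le_rfl]
  rcases hA with h1 | ⟨i, h1, h2, h3⟩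
  · exact Or.inl h1
  · exact Or.inr ⟨i, h1, h2.trans (h i (by omega)), h3⟩

theorem IsAdmissible.lt {v : Perm ℕ} {k : ℕ} (hinc : IncreasingFrom v k) {A : ℕ → ℕ} {j : ℕ}
    (h : ∀ i ≤ j, IsAdmissible v k A i) : v (A j) < v (k + j) := by
  induction j with
  | zero =>
    rcases h 0 le_rfl with h1 | ⟨i, h1, -⟩
    · exact h1.1
    · omega
  | succ j ih =>
    rcases h (j + 1) le_rfl with h1 | ⟨i, h1, h2, -⟩
    · exact h1.1
    · obtain rfl : j = i := by omega
      rw [h2]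
      exact (ih fun i hi => h i (by omega)).trans (hinc.lt (by omega) (by omega))

/-- In an admissible chain with last position `i`, the position `i` occurs exactly from the step
on whose window of values contains `v i`. -/
theorem admissible_last {v : Perm ℕ} {k : ℕ} (hinc : IncreasingFrom v k) {A : ℕ → ℕ} {m l i : ℕ}
    (hA : ∀ j < m, IsAdmissible v k A j) (hm : A (m - 1) = i) (hlm : l < m)
    (hl : ∀ j < l, v (k + j) < v i) (hl' : v i < v (k + l)) :
    (∀ j < l, A j ≠ i) ∧ (∀ j, l ≤ j → j < m → A j = i) ∧
      ∀ q, i < q → q < k → v i < v q → ¬v q < v (k + m - 1) := by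
  have hne : ∀ j < l, A j ≠ i := by
    intro j hj hc
    have h1 := IsAdmissible.lt hinc (A := A) (j := j) fun i hi => hA i (by omega)
    have h2 := hl j hj
    rw [hc] at h1
    omega
  have hge : ∀ j, l ≤ j → v i < v (k + j) := by
    intro j hj
    rcases hj.lt_or_eq with h | rfl
    · exact hl'.trans (hinc.lt (by omega) (by omega))
    · exact hl'
  have hstep : ∀ j, l ≤ j → A (j + 1) = i → j + 1 < m → A j = i ∧
      ∀ q, i < q → q < k → v (k + j) < v q → ¬v q < v (k + (j + 1)) := by
    intro j hj h1 h2
    rcases hA (j + 1) h2 with ⟨-, h3, -⟩ | ⟨j', h3, h4, h5⟩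
    · have h6 := h3 j rfl
      have h7 := hge j hj
      rw [h1] at h6
      omega
    · obtain rfl : j = j' := by omega
      rw [h1] at h4 h5
      exact ⟨h4.symm, h5⟩
  -- Backwards from the end: as long as v i is below the window of step j+1, using `i` there is
  -- possible only as a repetition of step j.
  have heq : ∀ d, l + d < m → A (m - 1 - d) = i := by
    intro d hd
    induction d with
    | zero => exact hm
    | succ d ih =>
      refine (hstep (m - 1 - (d + 1)) (by omega) ?_ (by omega)).1
      rw [← ih (by omega)]
      congr 1
      omega
  have heq' : ∀ j, l ≤ j → j < m → A j = i := by
    intro j hj hj'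
    rw [← heq (m - 1 - j) (by omega)]
    congr 1
    omega
  refine ⟨hne, heq', fun q h1 h2 h3 => ?_⟩
  -- The windows of the successive steps of the run fill the interval from v i up to v(k+m-1); their
  -- common endpoints are values in positions ≥ k, hence not v q.
  have key : ∀ j, l ≤ j → j < m → ¬v q < v (k + j) := by
    intro j hj
    induction j, hj using Nat.le_induction with
    | base =>
      intro hj
      have h0 := heq' l le_rfl hj
      rcases hA l hj with ⟨-, -, h4⟩ | ⟨j', h4, h5, -⟩
      · rw [h0] at h4
        exact h4 q h1 h2 h3
      · exact absurd (h5.symm.trans h0) (hne j' (by omega))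
    | succ j hj ih =>
      intro hj'
      have h4 := ih (by omega)
      have h5 := ne_of_ne v (show q ≠ k + j by omega)
      exact (hstep j hj (heq' _ (by omega) hj') hj').2 q h1 h2 (by omega)
  have := key (m - 1) (by omega) (by omega)
  rwa [← Nat.add_sub_assoc (by omega)] at this

/-- Converse of `admissible_last`: the single cover condition on the whole interval above v i
restricts to the window of each step of the run. -/
theorem admissible_of_last {v : Perm ℕ} {k : ℕ} (hinc : IncreasingFrom v k) {A : ℕ → ℕ}
    {m l i : ℕ} (hA : ∀ j < l, IsAdmissible v k A j)
    (hA' : ∀ j, l ≤ j → j < m → A j = i) (hl : ∀ j < l, v (k + j) < v i)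
    (hl' : v i < v (k + l)) (hcov : ∀ q, i < q → q < k → v i < v q → ¬v q < v (k + m - 1)) :
    ∀ j < m, IsAdmissible v k A j := by
  have hle : ∀ j < m, ∀ q, v q < v (k + j) → v q < v (k + m - 1) := by
    intro j hj q hq
    rcases Nat.lt_or_ge j (m - 1) with h | h
    · exact hq.trans (hinc.lt (by omega) (by omega))
    · have : k + m - 1 = k + j := by omega
      rwa [this]
  intro j hj
  rcases lt_trichotomy j l with h | rfl | h
  · exact hA j h
  · have h0 := hA' j le_rfl hj
    refine Or.inl ?_
    rw [h0]
    exact ⟨hl', fun i' hi' => hl i' (by omega),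
      fun q h1 h2 h3 h4 => hcov q h1 h2 h3 (hle j hj q h4)⟩
  · obtain ⟨j', rfl⟩ : ∃ j', j = j' + 1 := ⟨j - 1, by omega⟩
    refine Or.inr ⟨j', rfl, ?_, ?_⟩
    · rw [hA' _ (by omega) hj, hA' j' (by omega) (by omega)]
    · rw [hA' _ (by omega) hj]
      intro q h1 h2 h3 h4
      refine hcov q h1 h2 ?_ (hle _ hj q h4)
      rcases Nat.lt_or_ge l j' with h5 | h5
      · have := hinc.lt (show k ≤ k + l by omega) (show k + l < k + j' by omega)
        omega
      · obtain rfl : l = j' := by omega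
        omega

/-- Admissibility does not see a change of the value in position `i`, as long as both values
exceed those at the positions in question. -/
theorem IsAdmissible.of_agree {v v' : Perm ℕ} {k : ℕ} {A : ℕ → ℕ} {l i j : ℕ} (hj : j < l)
    (hAk : A j < k) (hA : ∀ j < l, A j ≠ i) (hright : ∀ j < l, v' (k + j) = v (k + j))
    (hleft : ∀ q < k, q ≠ i → v' q = v q) (hbig : ∀ j < l, v (k + j) < v' i)
    (h : IsAdmissible v k A j) : IsAdmissible v' k A j := by
  unfold IsAdmissible at h ⊢
  rw [hright j hj, hleft _ hAk (hA j hj)]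
  have hb := hbig j hj
  rcases h with ⟨h1, h2, h3⟩ | ⟨j', h1, h2, h3⟩
  · refine Or.inl ⟨h1, fun j' hj' => ?_, fun q hq hq' h4 => ?_⟩
    · rw [hright j' (by omega)]
      exact h2 j' hj'
    · by_cases hqi : q = i
      · subst hqi
        omega
      · rw [hleft q hq' hqi] at h4 ⊢
        exact h3 q hq hq' h4
  · refine Or.inr ⟨j', h1, h2, fun q hq hq' h4 => ?_⟩
    by_cases hqi : q = i
    · subst hqi
      omega
    · rw [hright j' (by omega), hleft q hq' hqi] at h4
      rw [hleft q hq' hqi]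
      exact h3 q hq hq' h4

/-! ### The transition recursion and chains -/

theorem formPerm_range' (k m j : ℕ) (hj : j ≤ m) :
    (List.range' k (m + 1)).formPerm (k + j) = if j < m then k + j + 1 else k := by
  have h := List.formPerm_apply_getElem (List.range' k (m + 1)) List.nodup_range' j
    (by simp; omega)
  simp only [List.getElem_range', List.length_range', one_mul] at h
  rw [h]
  split_ifs with hjm
  · rw [Nat.mod_eq_of_lt (by omega)]
    omega
  · obtain rfl : j = m := by omega
    simp

theorem hat_of_notMem (w : Perm ℕ) {k m x : ℕ} (hx : x < k ∨ k + m < x) : hat w k m x = w x := by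
  rw [hat, Perm.mul_apply, List.formPerm_apply_of_notMem]
  rw [List.mem_range'_1]
  omega

theorem hat_add (w : Perm ℕ) {k m j : ℕ} (hj : j < m) : hat w k m (k + j) = w (k + j + 1) := by
  rw [hat, Perm.mul_apply, formPerm_range' k m j hj.le, if_pos hj]

theorem hat_top (w : Perm ℕ) (k m : ℕ) : hat w k m (k + m) = w k := by
  rw [hat, Perm.mul_apply, formPerm_range' k m m le_rfl, if_neg (lt_irrefl m)]

theorem hat_zero (w : Perm ℕ) (k : ℕ) : hat w k 0 = w := by
  simp [hat]

theorem hat_succ (w : Perm ℕ) (k m : ℕ) :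
    hat w k (m + 1) = hat w k m * swap (k + m) (k + m + 1) := by
  ext x
  rw [Perm.mul_apply]
  by_cases h1 : x < k
  · rw [swap_apply_of_ne_of_ne (by omega) (by omega), hat_of_notMem w (by omega),
      hat_of_notMem w (by omega)]
  obtain ⟨j, rfl⟩ : ∃ j, x = k + j := ⟨x - k, by omega⟩
  rcases lt_trichotomy j m with h | rfl | h
  · rw [swap_apply_of_ne_of_ne (by omega) (by omega), hat_add w h, hat_add w (by omega)]
  · rw [swap_apply_left, hat_add w (by omega), hat_of_notMem w (by omega)]
  · by_cases h2 : j = m + 1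
    · rw [h2, hat_top, ← add_assoc, swap_apply_right, hat_top]
    · rw [swap_apply_of_ne_of_ne (by omega) (by omega), hat_of_notMem w (by omega),
        hat_of_notMem w (by omega)]

/-- The entry w_k passes `m` smaller entries, each passage removing one inversion. A chain of m
steps that returns to the length of w must therefore gain exactly one at each step. -/
theorem len_hat {w : Perm ℕ} (hw : IsFinitary w) {k m : ℕ} (h : ∀ j < m, w (k + j + 1) < w k) :
    IsFinitary (hat w k m) ∧ len w = len (hat w k m) + m := by
  induction m with
  | zero => exact ⟨by rwa [hat_zero], by rw [hat_zero, add_zero]⟩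
  | succ m ih =>
    obtain ⟨h1, h2⟩ := ih fun j hj => h j (by omega)
    refine ⟨by rw [hat_succ]; exact h1.mul (isFinitary_swap _ _), ?_⟩
    rw [h2, len_mul_swap_succ_of_gt h1 (i := k + m), ← hat_succ]
    · ring
    · rw [hat_top, hat_of_notMem w (by omega)]
      exact h m (by omega)

/-- The final position `k + m` to which the entry in position `k` is moved. -/
structure IsDrop (w : Perm ℕ) (k m : ℕ) : Prop where
  increasing : IncreasingFrom w (k + 1)
  lt : ∀ j < m, w (k + j + 1) < w k
  gt : w k < w (k + m + 1)

theorem IsDrop.increasingFrom_hat {w : Perm ℕ} {k m : ℕ} (h : IsDrop w k m) :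
    IncreasingFrom (hat w k m) k := by
  intro x hx
  obtain ⟨j, rfl⟩ : ∃ j, x = k + j := ⟨x - k, by omega⟩
  rcases lt_trichotomy j m with h1 | rfl | h1
  · rw [hat_add w h1]
    by_cases h2 : j + 1 = m
    · subst h2
      rw [add_assoc, hat_top]
      exact h.lt j (by omega)
    · rw [add_assoc, hat_add w (by omega)]
      exact h.increasing _ (by omega)
  · rw [hat_top, hat_of_notMem w (by omega)]
    exact h.gt
  · rw [hat_of_notMem w (by omega), hat_of_notMem w (by omega)]
    exact h.increasing _ (by omega)

open Classical in
/-- The transition recursion for truncated Schubert polynomials. -/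
theorem IsDrop.transition {w : Perm ℕ} (hw : IsFinitary w) {k m : ℕ} (h : IsDrop w k m)
    (hm : 0 < m) :
    truncSchubert k w = ∑ i ∈ Finset.range k,
      if w i < w (k + m) ∧ ∀ q, i < q → q < k → w i < w q → ¬w q < w (k + m) then
        truncSchubert k (w * swap k (k + m) * swap i k) else 0 := by
  obtain ⟨N, hN⟩ := (isFinitary_iff w).1 hw
  set v := w * swap k (k + m) with hv
  have hvf : IsFinitary v := hw.mul (isFinitary_swap _ _)
  have hvk : v k = w (k + m) := by simp [hv]
  have hvkm : v (k + m) = w k := by simp [hv]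
  have hvx : ∀ x, x ≠ k → x ≠ k + m → v x = w x := fun x h1 h2 => by
    rw [hv, Perm.mul_apply, swap_apply_of_ne_of_ne h1 h2]
  have hwkm : w (k + m) < w k := by
    have := h.lt (m - 1) (by omega)
    rwa [show k + (m - 1) + 1 = k + m by omega] at this
  -- Monk's rule at p = k, the first position whose variable is truncated, so the product side is
  -- zero.
  have hM := monk_truncSchubert k (K := N + k + m + 1) (by omega) v
    ((hN.mono (by omega)).mul_swap (by omega) (by omega)) k (by omega)
  rw [if_neg (lt_irrefl k), zero_mul, monk] at hM
  have hterm : ∀ b ∈ Finset.range (N + k + m + 1 + 1),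
      (if len (v * swap k b) = len v + 1 then
        (if k < b then truncSchubert k (v * swap k b) else -truncSchubert k (v * swap k b)) else 0) =
      (if b = k + m then truncSchubert k w else 0) - (if b < k then
        (if w b < w (k + m) ∧ ∀ q, b < q → q < k → w b < w q → ¬w q < w (k + m) then
          truncSchubert k (v * swap b k) else 0) else 0) := by
    intro b _
    rcases lt_trichotomy b k with hb | rfl | hb
    · have hiff : len (v * swap b k) = len v + 1 ↔
          w b < w (k + m) ∧ ∀ q, b < q → q < k → w b < w q → ¬w q < w (k + m) := by
        rw [len_mul_swap_eq_iff hvf hb, hvk, hvx b (by omega) (by omega)]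
        refine and_congr_right fun _ => forall_congr' fun q => forall_congr' fun h1 =>
          forall_congr' fun h2 => ?_
        rw [hvx q (by omega) (by omega)]
      rw [if_neg (show ¬b = k + m by omega), if_pos hb, if_neg (show ¬k < b by omega), swap_comm,
        zero_sub]
      simp only [hiff]
      split_ifs <;> simp
    · have : v * swap b b = v := by
        rw [swap_self]
        rfl
      rw [this]
      simp [hm.ne']
    -- Positions strictly between k and k+m hold values below v k, and beyond k+m the value w k in
    -- position k+m obstructs the cover.
    · have hiff : len (v * swap k b) = len v + 1 ↔ b = k + m := by
        rw [len_mul_swap_eq_iff hvf hb, hvk]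
        constructor
        · rintro ⟨h1, h2⟩
          rcases lt_trichotomy b (k + m) with h3 | h3 | h3
          · rw [hvx b (by omega) (by omega)] at h1
            have := h.increasing.lt (show k + 1 ≤ b by omega) h3
            omega
          · exact h3
          · have h4 := h2 (k + m) (by omega) h3
            rw [hvkm, hvx b (by omega) (by omega)] at h4
            have h5 : w k < w b := by
              rcases Nat.lt_or_ge (k + m + 1) b with h6 | h6
              · exact h.gt.trans (h.increasing.lt (by omega) h6)
              · obtain rfl : b = k + m + 1 := by omega
                exact h.gt
            omega
        · rintro rfl
          rw [hvkm]
          refine ⟨hwkm, fun q h1 h2 h3 => ?_⟩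
          rw [hvx q (by omega) (by omega)] at h3
          have := h.increasing.lt (show k + 1 ≤ q by omega) h2
          omega
      simp only [hiff]
      rw [if_neg (show ¬b < k by omega), sub_zero]
      split_ifs with h1
      · rw [h1, hv, mul_assoc, swap_mul_self, mul_one]
      · rfl
  rw [Finset.sum_congr rfl hterm, Finset.sum_sub_distrib, Finset.sum_ite_eq',
    if_pos (Finset.mem_range.2 (by omega)),
    ← Finset.sum_filter, sub_eq_zero] at hM
  rw [hM]
  refine Finset.sum_congr (Finset.ext fun b => ?_) fun _ _ => rfl
  simp only [Finset.mem_filter, Finset.mem_range]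
  omega

/-! ### Matching the recursion with chains -/

/-- Extension of a finite sequence by zeros. -/
def extendZero {k m : ℕ} (a : Fin m → Fin k) (j : ℕ) : ℕ := if h : j < m then a ⟨j, h⟩ else 0

theorem extendZero_of_lt {k m : ℕ} (a : Fin m → Fin k) {j : ℕ} (h : j < m) :
    extendZero a j = a ⟨j, h⟩ := dif_pos h

theorem extendZero_lt {k m : ℕ} (a : Fin m → Fin k) {j : ℕ} (h : j < m) : extendZero a j < k := by
  rw [extendZero_of_lt a h]
  exact (a _).2

theorem extendZero_injective {k m : ℕ} {a b : Fin m → Fin k}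
    (h : ∀ j < m, extendZero a j = extendZero b j) : a = b := by
  funext j
  have := h j j.2
  rw [extendZero_of_lt a j.2, extendZero_of_lt b j.2] at this
  exact Fin.ext this

/-- Extension of a sequence of length `l` to length `m` by the constant `i`. -/
def extendConst {k l : ℕ} (m : ℕ) (a : Fin l → Fin k) (i : Fin k) (j : Fin m) : Fin k :=
  if h : (j : ℕ) < l then a ⟨j, h⟩ else i

theorem extendZero_extendConst_of_lt {k l m : ℕ} (hlm : l ≤ m) (a : Fin l → Fin k) (i : Fin k)
    {j : ℕ} (hj : j < l) : extendZero (extendConst m a i) j = extendZero a j := by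
  rw [extendZero_of_lt _ (by omega), extendZero_of_lt _ hj, extendConst, dif_pos hj]

theorem extendZero_extendConst_of_ge {k l m : ℕ} (a : Fin l → Fin k) (i : Fin k)
    {j : ℕ} (hj : l ≤ j) (hjm : j < m) : extendZero (extendConst m a i) j = i := by
  rw [extendZero_of_lt _ hjm, extendConst, dif_neg (by simpa using hj)]

-- Strong induction on `m`: the chains with last position `i` correspond to the term u = w t_{k,k+m}
-- t_{ik} of the transition recursion. Chains for u, of length l < m, are extended by the constant
-- `i`.
open Classical in
theorem IsDrop.truncSchubert_eq_sum {k : ℕ} (m : ℕ) : ∀ {w : Perm ℕ}, IsFinitary w →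
    IsDrop w k m → truncSchubert k w = ∑ a : Fin m → Fin k with
      (∀ j < m, IsAdmissible (hat w k m) k (extendZero a) j),
        truncSchubert k (chain (hat w k m) k (extendZero a) m) := by
  induction m using Nat.strong_induction_on with
  | _ m ih =>
  intro w hw h
  rcases Nat.eq_zero_or_pos m with rfl | hm
  · simp [chain, hat_zero]
  have hinc := h.increasingFrom_hat
  set v := hat w k m with hv
  have hvlt : ∀ x < k, v x = w x := fun x hx => hat_of_notMem w (Or.inl hx)
  have hvm : v (k + m - 1) = w (k + m) := by
    rw [show k + m - 1 = k + (m - 1) by omega, hv, hat_add w (by omega)]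
    congr 1
    omega
  rw [h.transition hw hm, ← Finset.sum_fiberwise_of_maps_to
    (g := fun a : Fin m → Fin k => extendZero a (m - 1)) (t := Finset.range k)
    fun a _ => Finset.mem_range.2 (extendZero_lt a (by omega))]
  refine Finset.sum_congr rfl fun i hi => ?_
  rw [Finset.mem_range] at hi
  -- Here `l` is the step whose window contains v i; it is also the number of places that the entry
  -- in position k of u will drop.
  have hfind : v i < v (k + m - 1) → ∃ l < m, (∀ j < l, v (k + j) < v i) ∧ v i < v (k + l) := by
    intro h1
    have hex : ∃ l, v i < v (k + l) :=
      ⟨m - 1, by rwa [show k + (m - 1) = k + m - 1 by omega]⟩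
    refine ⟨Nat.find hex, ?_, fun j hj => ?_, Nat.find_spec hex⟩
    · have := Nat.find_min' hex (m := m - 1) (by rwa [show k + (m - 1) = k + m - 1 by omega])
      omega
    · have h2 := Nat.find_min hex hj
      have h3 := ne_of_ne v (show k + j ≠ i by omega)
      omega
  have hcond : (w i < w (k + m) ∧ ∀ q, i < q → q < k → w i < w q → ¬w q < w (k + m)) ↔
      (v i < v (k + m - 1) ∧ ∀ q, i < q → q < k → v i < v q → ¬v q < v (k + m - 1)) := by
    rw [hvm, hvlt i hi]
    refine and_congr_right fun _ => forall_congr' fun q => forall_congr' fun h1 =>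
          forall_congr' fun h2 => ?_
    rw [hvlt q h2]
  by_cases hc : v i < v (k + m - 1) ∧ ∀ q, i < q → q < k → v i < v q → ¬v q < v (k + m - 1)
  swap
  · rw [if_neg (hcond.not.2 hc), eq_comm]
    refine Finset.sum_eq_zero fun a ha => absurd ?_ hc
    simp only [Finset.mem_filter, Finset.mem_univ, true_and] at ha
    have h1 := IsAdmissible.lt hinc (A := extendZero a) (j := m - 1)
      fun j hj => ha.1 j (by omega)
    rw [ha.2, show k + (m - 1) = k + m - 1 by omega] at h1
    obtain ⟨l, hl1, hl2, hl3⟩ := hfind h1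
    exact ⟨h1, (admissible_last hinc ha.1 ha.2 hl1 hl2 hl3).2.2⟩
  rw [if_pos (hcond.2 hc)]
  obtain ⟨hc1, hc2⟩ := hc
  obtain ⟨l, hlm, hl, hl'⟩ := hfind hc1
  set u := w * swap k (k + m) * swap i k with hu
  have hui : u i = w (k + m) := by
    rw [hu, Perm.mul_apply, swap_apply_left, Perm.mul_apply, swap_apply_left]
  have huk : u k = w i := by
    rw [hu, Perm.mul_apply, swap_apply_right, Perm.mul_apply,
      swap_apply_of_ne_of_ne (by omega) (by omega)]
  have hukm : u (k + m) = w k := by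
    rw [hu, Perm.mul_apply, swap_apply_of_ne_of_ne (by omega) (by omega), Perm.mul_apply,
      swap_apply_right]
  have hux : ∀ x, x ≠ i → x ≠ k → x ≠ k + m → u x = w x := by
    intro x h1 h2 h3
    rw [hu, Perm.mul_apply, swap_apply_of_ne_of_ne h1 h2, Perm.mul_apply,
      swap_apply_of_ne_of_ne h2 h3]
  have huf : IsFinitary u := (hw.mul (isFinitary_swap _ _)).mul (isFinitary_swap _ _)
  have hvadd : ∀ j < m, v (k + j) = w (k + j + 1) := fun j hj => hat_add w hj
  have hwkm : w (k + m) < w k := by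
    have := h.lt (m - 1) (by omega)
    rwa [show k + (m - 1) + 1 = k + m by omega] at this
  have hdrop : IsDrop u k l := by
    refine ⟨fun x hx => ?_, fun j hj => ?_, ?_⟩
    · by_cases h1 : x = k + m
      · rw [h1, hukm, hux _ (by omega) (by omega) (by omega)]
        exact h.gt
      · rw [hux x (by omega) (by omega) h1]
        by_cases h2 : x + 1 = k + m
        · rw [h2, hukm]
          have := h.increasing x hx
          rw [h2] at this
          omega
        · rw [hux _ (by omega) (by omega) h2]
          exact h.increasing x hx
    · have := hl j hj
      rw [hvadd j (by omega), hvlt i hi] at this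
      rwa [huk, hux _ (by omega) (by omega) (by omega)]
    · rw [huk]
      by_cases h1 : l + 1 = m
      · rw [add_assoc, h1, hukm]
        rw [hvm, hvlt i hi] at hc1
        omega
      · rw [hux _ (by omega) (by omega) (by omega), ← hvadd l hlm, ← hvlt i hi]
        exact hl'
  rw [ih l hlm huf hdrop]
  set v' := hat u k l with hv'
  have hv'i : v' i = v (k + m - 1) := by
    rw [hv', hat_of_notMem u (Or.inl hi), hui, hvm]
  have hright : ∀ j < l, v' (k + j) = v (k + j) := by
    intro j hj
    rw [hv', hat_add u hj, hux _ (by omega) (by omega) (by omega), hvadd j (by omega)]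
  have hleft : ∀ q < k, q ≠ i → v' q = v q := by
    intro q hq hqi
    rw [hv', hat_of_notMem u (Or.inl hq), hux q hqi (by omega) (by omega), hvlt q hq]
  have hbig : ∀ j < l, v (k + j) < v' i := by
    intro j hj
    rw [hv'i]
    exact (hl j hj).trans hc1
  have hinc' := hdrop.increasingFrom_hat
  rw [← hv'] at hinc'
  -- The run of `i` in steps l, …, m-1, performed first, turns the `hat` of w into the `hat` of u,
  -- so corresponding chains have the same endpoint.
  have hchain : ∀ A : ℕ → ℕ, (∀ j < l, A j < k ∧ A j ≠ i) → (∀ j, l ≤ j → j < m → A j = i) →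
      chain v k A m = chain v' k A l := by
    intro A hA hA'
    refine chain_eq_chain_of_const hi hA hA' hlm v' hv'i ?_ ?_ ?_
    · rw [hv', hat_top, huk, hvlt i hi]
    · intro x h1 h2
      rw [hv', hat_of_notMem u (Or.inr h1), hux x (by omega) (by omega) (by omega)]
      have := hvadd (x - 1 - k) (by omega)
      rw [show k + (x - 1 - k) = x - 1 by omega, show x - 1 + 1 = x by omega] at this
      exact this.symm
    · intro x hxi hx
      rcases hx with hx | hx
      · by_cases hxk : x < k
        · exact hleft x hxk hxi
        · have := hright (x - k) (by omega)
          rwa [show k + (x - k) = x by omega] at this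
      · rw [hv', hat_of_notMem u (by omega)]
        rcases hx.lt_or_eq with h1 | rfl
        · rw [hux x (by omega) (by omega) (by omega), hv, hat_of_notMem w (by omega)]
        · rw [hukm, hv, hat_top]
  -- In v' position `i` holds v(k+m-1), too large to be raised by any of the first `l` steps; the
  -- shorter chain thus avoids `i` automatically.
  have hne' : ∀ A : ℕ → ℕ, (∀ j < l, IsAdmissible v' k A j) → ∀ j < l, A j ≠ i := by
    intro A hA j hj hAi
    have h1 := IsAdmissible.lt hinc' (A := A) (j := j) fun j' hj' => hA j' (by omega)
    rw [hAi, hright j hj] at h1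
    have h2 := hbig j hj
    omega
  refine Finset.sum_bij (fun a _ => extendConst m a ⟨i, hi⟩) ?_ ?_ ?_ ?_
  · intro a ha
    simp only [Finset.mem_filter, Finset.mem_univ, true_and] at ha ⊢
    have hlast : ∀ j, l ≤ j → j < m → extendZero (extendConst m a ⟨i, hi⟩) j = i :=
      fun j h1 h2 => extendZero_extendConst_of_ge a ⟨i, hi⟩ h1 h2
    refine ⟨?_, hlast _ (by omega) (by omega)⟩
    refine admissible_of_last hinc (fun j hj => ?_) hlast hl hl' hc2
    refine IsAdmissible.congr (A := extendZero a) (fun j' hj' =>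
      (extendZero_extendConst_of_lt hlm.le a _ (by omega)).symm) ?_
    exact (ha j hj).of_agree hj (extendZero_lt a hj) (hne' _ ha) (fun j hj => (hright j hj).symm)
      (fun q hq hqi => (hleft q hq hqi).symm) fun j hj => by
        rw [hright j hj]
        exact hl j hj
  · intro a _ b _ hab
    refine extendZero_injective fun j hj => ?_
    rw [← extendZero_extendConst_of_lt hlm.le a ⟨i, hi⟩ hj, hab,
      extendZero_extendConst_of_lt hlm.le b ⟨i, hi⟩ hj]
  · intro b hb
    simp only [Finset.mem_filter, Finset.mem_univ, true_and] at hb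
    obtain ⟨h1, h2, -⟩ := admissible_last hinc hb.1 hb.2 hlm hl hl'
    have heq : ∀ j < l, extendZero (fun j : Fin l => b (Fin.castLE hlm.le j)) j =
        extendZero b j := by
      intro j hj
      rw [extendZero_of_lt _ hj, extendZero_of_lt _ (by omega)]
      rfl
    refine ⟨fun j => b (Fin.castLE hlm.le j), ?_, extendZero_injective fun j hj => ?_⟩
    · simp only [Finset.mem_filter, Finset.mem_univ, true_and]
      intro j hj
      refine IsAdmissible.congr (A := extendZero b) (fun j' hj' => (heq j' (by omega)).symm) ?_
      exact (hb.1 j (by omega)).of_agree hj (extendZero_lt b (by omega)) h1 hright hleft hbig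
    · rcases Nat.lt_or_ge j l with h3 | h3
      · rw [extendZero_extendConst_of_lt hlm.le _ _ h3, heq j h3]
      · rw [extendZero_extendConst_of_ge _ _ h3 hj, h2 j h3 hj]
  · intro a ha
    simp only [Finset.mem_filter, Finset.mem_univ, true_and] at ha
    have heq : ∀ j < l, extendZero (extendConst m a ⟨i, hi⟩) j = extendZero a j :=
      fun j hj => extendZero_extendConst_of_lt hlm.le a _ hj
    rw [hchain (extendZero (extendConst m a ⟨i, hi⟩))
      (fun j hj => by
        rw [heq j hj]
        exact ⟨extendZero_lt a hj, hne' _ ha j hj⟩)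
      (fun j h1 h2 => extendZero_extendConst_of_ge a ⟨i, hi⟩ h1 h2)]
    rw [chain_congr heq]

/-! ### The truncation formula -/

theorem step_eq_chain (v : Perm ℕ) (k : ℕ) {m : ℕ} (a : Fin m → Fin k) {j : ℕ} (hj : j ≤ m) :
    step v k a j = chain v k (extendZero a) j := by
  induction j with
  | zero => simp [step, chain]
  | succ j ih =>
    rw [chain, ← ih (by omega), step, step, List.take_add_one, List.prod_append, mul_assoc]
    simp [extendZero, show j < m by omega]

theorem chain_apply_right (v : Perm ℕ) {k : ℕ} {A : ℕ → ℕ} {j l : ℕ} (hA : ∀ i < j, A i < k)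
    (hl : j ≤ l) : chain v k A j (k + l) = v (k + l) := by
  induction j with
  | zero => rfl
  | succ j ih =>
    have := hA j (by omega)
    rw [chain, Perm.mul_apply, swap_apply_of_ne_of_ne (by omega) (by omega),
      ih (fun i hi => hA i (by omega)) (by omega)]

/-- The last position used is where the value v(k+m-1-th step's entry), untouched until then, ends
up; cancelling that transposition recovers the rest. Hence distinct sequences have distinct
endpoints, and the `image` in `terms` loses no multiplicity. -/
theorem eq_of_chain_eq {v : Perm ℕ} {k : ℕ} {A B : ℕ → ℕ} {m : ℕ} (hA : ∀ i < m, A i < k)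
    (hB : ∀ i < m, B i < k) (h : chain v k A m = chain v k B m) : ∀ j < m, A j = B j := by
  induction m with
  | zero => simp
  | succ m ih =>
    have key : ∀ C : ℕ → ℕ, (∀ i < m + 1, C i < k) → chain v k C (m + 1) (C m) = v (k + m) := by
      intro C hC
      rw [chain, Perm.mul_apply, swap_apply_left,
        chain_apply_right v (fun i hi => hC i (by omega)) le_rfl]
    have hm : A m = B m := by
      refine (chain v k A (m + 1)).injective ?_
      rw [key A hA, h, key B hB]
    have h' : chain v k A m = chain v k B m := by
      rw [chain, chain, hm] at h
      exact mul_right_cancel h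
    intro j hj
    rcases Nat.lt_succ_iff_lt_or_eq.1 hj with h1 | rfl
    · exact ih (fun i hi => hA i (by omega)) (fun i hi => hB i (by omega)) h' j h1
    · exact hm

/-- Strict growth with total gain equal to the number of steps leaves exactly one unit per step;
this turns the length conditions in `terms` into cover conditions. -/
theorem forall_lt_and_eq_iff (f : ℕ → ℕ) (m : ℕ) :
    ((∀ j < m, f j < f (j + 1)) ∧ f m = f 0 + m) ↔ ∀ j < m, f (j + 1) = f j + 1 := by
  constructor
  · rintro ⟨h1, h2⟩
    have h3 : ∀ j ≤ m, f 0 + j ≤ f j := by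
      intro j hj
      induction j with
      | zero => rfl
      | succ j ih =>
        have := h1 j (by omega)
        have := ih (by omega)
        omega
    have h4 : ∀ j, j ≤ m → f j + (m - j) ≤ f m := by
      intro j hj
      induction hj using Nat.decreasingInduction with
      | self => simp
      | of_succ j hj ih =>
        have := h1 j hj
        omega
    intro j hj
    have := h1 j hj
    have := h3 j hj.le
    have := h4 (j + 1) hj
    omega
  · intro h
    refine ⟨fun j hj => by rw [h j hj]; omega, ?_⟩
    induction m with
    | zero => rfl
    | succ m ih =>
      have := h m (by omega)
      have := ih fun j hj => h j (by omega)
      omega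

theorem IsDrop.mem_terms_iff {w : Perm ℕ} (hw : IsFinitary w) {k m : ℕ} (h : IsDrop w k m)
    (a : Fin m → Fin k) :
    ((∀ j < m, len (step (hat w k m) k a j) < len (step (hat w k m) k a (j + 1))) ∧
      len (step (hat w k m) k a m) = len w) ↔
    ∀ j < m, IsAdmissible (hat w k m) k (extendZero a) j := by
  obtain ⟨h1, h2⟩ := len_hat hw h.lt
  rw [← forall_len_chain_succ_iff h1 h.increasingFrom_hat fun i hi => extendZero_lt a hi,
    ← forall_lt_and_eq_iff fun j => len (chain (hat w k m) k (extendZero a) j), h2]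
  refine and_congr (forall_congr' fun j => forall_congr' fun hj => ?_) ?_
  · rw [step_eq_chain _ _ _ hj.le, step_eq_chain _ _ _ hj]
  · rw [step_eq_chain _ _ _ le_rfl]
    rfl

theorem IsDrop.of_mem_terms {w : Perm ℕ} (hw : IsFinitary w) {k m : ℕ} (h : IsDrop w k m)
    {u : Perm ℕ} (hu : u ∈ terms w k m) : IsFinitary u ∧ IncreasingFrom u k := by
  classical
  obtain ⟨a, ha, rfl⟩ := Finset.mem_image.1 hu
  have ha' := (h.mem_terms_iff hw a).1 (Finset.mem_filter.1 ha).2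
  obtain ⟨h1, -⟩ := len_hat hw h.lt
  have hA : ∀ i < m, extendZero a i < k := fun i hi => extendZero_lt a hi
  rw [step_eq_chain _ _ _ le_rfl]
  exact ⟨isFinitary_chain h1 _ _ _, (chainInvariant h1 h.increasingFrom_hat hA
    ((forall_len_chain_succ_iff h1 h.increasingFrom_hat hA).2 ha')).increasing⟩

theorem IsDrop.truncSchubert_eq_sum_terms {w : Perm ℕ} (hw : IsFinitary w) {k m : ℕ}
    (h : IsDrop w k m) : truncSchubert k w = ∑ u ∈ terms w k m, schubert u := by
  classical
  trans ∑ u ∈ terms w k m, truncSchubert k u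
  · rw [terms, Finset.sum_image, h.truncSchubert_eq_sum m hw]
    · refine Finset.sum_congr (Finset.ext fun a => ?_) fun a _ => ?_
      · simp only [Finset.mem_filter, Finset.mem_univ, true_and]
        exact (h.mem_terms_iff hw a).symm
      · rw [step_eq_chain _ _ _ le_rfl]
    · intro a _ b _ hab
      simp only [step_eq_chain _ _ _ le_rfl] at hab
      exact extendZero_injective (eq_of_chain_eq (fun i hi => extendZero_lt a hi)
        (fun i hi => extendZero_lt b hi) hab)
  · refine Finset.sum_congr rfl fun u hu => ?_
    obtain ⟨h1, h2⟩ := h.of_mem_terms hw hu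
    exact truncSchubert_of_increasingFrom h1 h2

theorem IsFinalDescent.increasingFrom {w : Perm ℕ} {k : ℕ} (h : IsFinalDescent w k) :
    IncreasingFrom w (k + 1) := fun i hi => h.2 i hi

theorem IsFinalDescent.isDrop {w : Perm ℕ} {k m : ℕ} (h : IsFinalDescent w k)
    (hm : IsGreatest {i | w i < w k} (k + m)) : IsDrop w k m := by
  refine ⟨h.increasingFrom, fun j hj => ?_, ?_⟩
  · have h1 : w (k + m) < w k := hm.1
    rcases Nat.lt_or_ge (j + 1) m with h2 | h2
    · exact (h.increasingFrom.lt (by omega) (by omega)).trans h1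
    · obtain rfl : m = j + 1 := by omega
      exact h1
  · by_contra hc
    have h1 := ne_of_ne w (show k ≠ k + m + 1 by omega)
    have : k + m + 1 ≤ k + m := hm.2 (show w (k + m + 1) < w k by omega)
    omega

/-! ### Iterated truncation and Schubert positivity -/

theorem vars_truncate (n : ℕ) (f : MvPolynomial ℕ ℤ) : ∀ i ∈ (truncate n f).vars, i < n := by
  intro i hi
  have h := MvPolynomial.vars_bind₁
    (fun i => if i < n then (MvPolynomial.X i : MvPolynomial ℕ ℤ) else 0) f hi
  obtain ⟨j, -, hj⟩ := Finset.mem_biUnion.1 h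
  split_ifs at hj with hjn
  · rw [MvPolynomial.vars_X, Finset.mem_singleton] at hj
    omega
  · simp at hj

theorem truncate_truncate {n d : ℕ} (h : n ≤ d) (f : MvPolynomial ℕ ℤ) :
    truncate n (truncate d f) = truncate n f := by
  rw [truncate, truncate, truncate, ← AlgHom.comp_apply]
  congr 1
  refine MvPolynomial.algHom_ext fun i => ?_
  rw [AlgHom.comp_apply, MvPolynomial.aeval_X, MvPolynomial.aeval_X]
  by_cases hi : i < n
  · simp [hi, hi.trans_le h]
  · by_cases hd : i < d
    · simp [hi, hd]
    · simp [hi, hd]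

theorem isSchubertPositive_sum {ι : Type*} (s : Finset ι) (f : ι → MvPolynomial ℕ ℤ)
    (h : ∀ i ∈ s, IsSchubertPositive (f i)) : IsSchubertPositive (∑ i ∈ s, f i) := by
  classical
  refine Finset.sum_induction f IsSchubertPositive ?_ ⟨0, by simp, by simp⟩ h
  rintro _ _ ⟨c, hc, rfl⟩ ⟨d, hd, rfl⟩
  refine ⟨c + d, fun u hu => ?_, ?_⟩
  · rcases Finset.mem_union.1 (Finsupp.support_add hu) with h | h
    · exact hc u h
    · exact hd u h
  · exact (Finsupp.sum_add_index' (h := fun u n => n • schubert u) (fun _ => zero_smul _ _)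
      fun _ _ _ => add_smul _ _ _).symm

theorem isSchubertPositive_schubert {u : Perm ℕ} (hu : IsFinitary u) :
    IsSchubertPositive (schubert u) := by
  refine ⟨Finsupp.single u 1, fun v hv => ?_, by simp⟩
  obtain rfl : v = u := by simpa using Finsupp.support_single_subset hv
  exact hu

/-- Induction on a bound `d` for the start of the increasing tail. Truncation to n ≤ d variables
factors through truncation to d, and the truncation formula replaces w by permutations that increase
already from d. -/
theorem isSchubertPositive_truncSchubert (n d : ℕ) : ∀ {w : Perm ℕ}, IsFinitary w →
    IncreasingFrom w d → IsSchubertPositive (truncSchubert n w) := by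
  induction d with
  | zero =>
    intro w hw h
    rw [truncSchubert_of_increasingFrom hw fun i _ => h i (by omega)]
    exact isSchubertPositive_schubert hw
  | succ d ih =>
    intro w hw h
    by_cases hdn : d < n
    · rw [truncSchubert_of_increasingFrom hw fun i _ => h i (by omega)]
      exact isSchubertPositive_schubert hw
    by_cases hd : w d < w (d + 1)
    · refine ih hw fun i hi => ?_
      rcases hi.lt_or_eq with h1 | rfl
      · exact h i h1
      · exact hd
    have hdesc : IsFinalDescent w d :=
      ⟨by have := ne_of_ne w (show d ≠ d + 1 by omega); omega, fun i hi => h i hi⟩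
    have hfin : {i | w i < w d}.Finite :=
      (Set.finite_lt_nat (w d)).preimage w.injective.injOn
    obtain ⟨b, hb⟩ := hfin.exists_maximal ⟨d + 1, hdesc.1⟩
    have hgr : IsGreatest {i | w i < w d} b := ⟨hb.1, fun i hi => by
      by_contra hc
      exact hc (hb.2 hi (not_le.1 hc).le)⟩
    have hdb : d + 1 ≤ b := hgr.2 hdesc.1
    obtain ⟨m, rfl⟩ : ∃ m, b = d + m := ⟨b - d, by omega⟩
    have hdrop := hdesc.isDrop hgr
    have h1 : truncSchubert n w = ∑ u ∈ terms w d m, truncSchubert n u := by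
      rw [truncSchubert, ← truncate_truncate (show n ≤ d by omega), ← truncSchubert,
        hdrop.truncSchubert_eq_sum_terms hw]
      exact map_sum (MvPolynomial.aeval (R := ℤ) (S₁ := MvPolynomial ℕ ℤ) (fun i : ℕ =>
        if i < n then MvPolynomial.X i else 0)) _ _
    rw [h1]
    refine isSchubertPositive_sum _ _ fun u hu => ?_
    obtain ⟨h2, h3⟩ := hdrop.of_mem_terms hw hu
    exact ih h2 h3

theorem IsFinitary.exists_increasingFrom {w : Perm ℕ} (hw : IsFinitary w) :
    ∃ N, IncreasingFrom w N := by
  obtain ⟨N, hN⟩ := (isFinitary_iff w).1 hw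
  refine ⟨N, fun i hi => ?_⟩
  rw [hN i hi, hN (i + 1) (by omega)]
  omega

end SchubertTruncation

theorem mainTheorem2 :
    (∀ (w : Equiv.Perm ℕ) (k m : ℕ), SchubertTruncation.IsFinitary w →
      SchubertTruncation.IsFinalDescent w k → IsGreatest {i | w i < w k} (k + m) →
        (∀ i ∈ (SchubertTruncation.schubert w).vars, i ≤ k) ∧
        SchubertTruncation.truncate k (SchubertTruncation.schubert w) =
          ∑ u ∈ SchubertTruncation.terms w k m, SchubertTruncation.schubert u) ∧
    (∀ (w : Equiv.Perm ℕ) (n : ℕ), SchubertTruncation.IsFinitary w →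
      SchubertTruncation.IsSchubertPositive
        (SchubertTruncation.truncate n (SchubertTruncation.schubert w))) := by
  refine ⟨fun w k m hw hk hm => ⟨fun i hi => ?_, ?_⟩, fun w n hw => ?_⟩
  · rw [← SchubertTruncation.truncSchubert_of_increasingFrom hw hk.increasingFrom] at hi
    exact Nat.lt_succ_iff.1 (SchubertTruncation.vars_truncate _ _ i hi)
  · exact (hk.isDrop hm).truncSchubert_eq_sum_terms hw
  · obtain ⟨N, hN⟩ := hw.exists_increasingFrom
    exact SchubertTruncation.isSchubertPositive_truncSchubert n N hw hN
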